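/- Let $F$ be an algebraically closed field of arbitrary characteristic, $R=F[[x_1,\dots,x_n]]$ and $\mathfrak m=\langle x_1,\dots,x_n\rangle$. Let $a=(a_1,\dots,a_n)$ be positive integers, $d=(d_1,\dots,d_m)$ non-negative integers and $r\ge 0$ an integer. For $h\in R$ let $v_a(h)\in\mathbb N\cup\{\infty\}$ be the minimum of $\sum_j a_j\alpha_j$ over the monomials $x^\alpha$ occurring in $h$, with $v_a(0)=\infty$. For $s\ge 0$ put $$F^s_{a,d}R^m=\{h\in R^m : v_a(h_i)\ge s+d_i \text{ for all } i\}.$$ For $f=(f_1,\dots,f_m)\in R^m$ let $$\widetilde T_f(F^1_{a,d}\mathcal K\cdot f)=\Big\{\Lambda f+\sum_{j=1}^n\xi_j\frac{\partial f}{\partial x_j}\ :\ \Lambda\in M_m(R),\ v_a(\Lambda_{ki})+d_i\ge d_k+1\ (1\le k,i\le m),\ \xi_j\in\mathfrak m,\ v_a(\xi_j)\ge a_j+1\ (1\le j\le n)\Big\}$$ be the tangent image at $f$ of the orbit of $f$ under the filtered contact group $F^1_{a,d}\mathcal K$. Call $f$ an isolated complete intersection singularity (ICIS) if the ideal $I=\langle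 f_1,\dots,f_m\rangle$ can be generated by $m$ elements of $\mathfrak m$ that form a regular sequence and $\mathfrak m^k\subset I+I_m(J(f))$ for some $k\in\mathbb N$, where $I_m(J(f))$ is the ideal generated by the $m\times m$ minors of the Jacobian matrix $J(f)=(\partial f_i/\partial x_j)$. Call $f$ weighted homogeneous of weight $r$ with respect to $(a;d)$ if $f_i(t^{a_1}x_1,\dots,t^{a_n}x_n)=t^{r+d_i}f_i(x_1,\dots,x_n)$ for all $t\in F$ and all $i$. Two elements $g,g'\in R^m$ are contact equivalent if $g'=U\cdot(\phi(g_1),\dots,\phi(g_m))$ for some $U\in GL(m,R)$ and some $F$-algebra automorphism $\phi$ of $R$. **Corollary (complete transversals in arbitrary characteristic).** Let $f\in R^m$ be an ICIS that is weighted homogeneous of weight $r$ with respect to $(a;d)$, and let $T$ be an $F$-linear subspace of $F^{r+1}_{a,d}R^m$ such that $$F^{r+1}_{a,d}R^m\subset T+\widetilde T_f(F^1_{a,d}\mathcal K\cdot f).$$ Then for every $g\in R^m$ with $g-f\in F^{r+1}_{a,d}R^m$ there is some $t\in T$ such that $g$ is contact equivalent to $f+t$. -/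

import Mathlib

open MvPowerSeries

namespace ContactGeometry

noncomputable section

/-- The ideal `𝔪 = ⟨x₁, …, xₙ⟩` of `R = F[[x₁, …, xₙ]]`. -/
def varIdeal (F : Type*) [Field F] (n : ℕ) : Ideal (MvPowerSeries (Fin n) F) :=
  Ideal.span (Set.range (fun j : Fin n => (X j : MvPowerSeries (Fin n) F)))

/-- The Jacobian matrix `(∂ fᵢ / ∂ xⱼ)` of `f ∈ R^m`. -/
def jacobian {F : Type*} [Field F] {n m : ℕ} (f : Fin m → MvPowerSeries (Fin n) F) :
    Matrix (Fin m) (Fin n) (MvPowerSeries (Fin n) F) :=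
  Matrix.of fun i j => pderiv F j (f i)

/-- The ideal generated by all `m × m` minors of the Jacobian matrix of `f ∈ R^m`. -/
def jacobianMinors {F : Type*} [Field F] {n m : ℕ} (f : Fin m → MvPowerSeries (Fin n) F) :
    Ideal (MvPowerSeries (Fin n) F) :=
  Ideal.span (Set.range fun e : Fin m ↪o Fin n => ((jacobian f).submatrix id e).det)

/-- The ideal `I` can be generated by `m` elements of `𝔪` that form a regular sequence. -/
def DefinesCompleteIntersection {F : Type*} [Field F] {n : ℕ} (m : ℕ)
    (I : Ideal (MvPowerSeries (Fin n) F)) : Prop :=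
  ∃ h : Fin m → MvPowerSeries (Fin n) F,
    (∀ i, h i ∈ varIdeal F n) ∧ Ideal.span (Set.range h) = I ∧
      RingTheory.Sequence.IsRegular (MvPowerSeries (Fin n) F) (List.ofFn h)

/-- `f = (f₁, …, fₘ)` is an isolated complete intersection singularity: `I = ⟨f₁, …, fₘ⟩`
defines a complete intersection and `𝔪^k ⊆ I + I_m(J(f))` for some `k`. -/
def IsICIS {F : Type*} [Field F] {n m : ℕ} (f : Fin m → MvPowerSeries (Fin n) F) : Prop :=
  DefinesCompleteIntersection m (Ideal.span (Set.range f)) ∧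
    ∃ k : ℕ, varIdeal F n ^ k ≤ Ideal.span (Set.range f) ⊔ jacobianMinors f

/-- `g` lies in the orbit of `f` under the contact group `GL(m, R) ⋊ Aut(R)`:
`g = U · φ(f)` for an invertible matrix `U` over `R` and an `F`-algebra automorphism `φ` of `R`. -/
def ContactEquiv {F : Type*} [Field F] {n m : ℕ} (f g : Fin m → MvPowerSeries (Fin n) F) : Prop :=
  ∃ (U : Matrix.GeneralLinearGroup (Fin m) (MvPowerSeries (Fin n) F))
    (φ : MvPowerSeries (Fin n) F ≃ₐ[F] MvPowerSeries (Fin n) F),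
    g = (U : Matrix (Fin m) (Fin m) (MvPowerSeries (Fin n) F)).mulVec (fun i => φ (f i))

/-- `fᵢ(t^{a₁} x₁, …, t^{aₙ} xₙ) = t^{r + dᵢ} fᵢ(x₁, …, xₙ)` for all `t ∈ F` and all `i`. -/
def IsWeightedHomog {F : Type*} [Field F] {n m : ℕ} (a : Fin n → ℕ) (d : Fin m → ℕ) (r : ℕ)
    (f : Fin m → MvPowerSeries (Fin n) F) : Prop :=
  ∀ (t : F) (i : Fin m), rescale (fun j => t ^ a j) (f i) = t ^ (r + d i) • f i

/-- The filtration `F^r_{a,d} R^m`. The monomial `x^α eᵢ` has degree `⟨a, α⟩ - dᵢ` with respect to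
`(a; d)`; the submodule consists of the vectors all of whose monomials have degree at least `r`. -/
def weightFiltration (F : Type*) [Field F] {n m : ℕ} (a : Fin n → ℕ) (d : Fin m → ℕ) (r : ℕ) :
    Submodule (MvPowerSeries (Fin n) F) (Fin m → MvPowerSeries (Fin n) F) where
  carrier := {h | ∀ i, ((r + d i : ℕ) : ℕ∞) ≤ (h i).weightedOrder a}
  zero_mem' := fun i => by simp
  add_mem' := fun {h k} hh hk i =>
    (le_min (hh i) (hk i)).trans (min_weightedOrder_le_add a)
  smul_mem' := fun c h hh i =>
    ((hh i).trans le_add_self).trans (le_weightedOrder_mul a (f := c) (g := h i))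

/-- The matrices `Λ` over `R` for which `Λⱼᵢ` has order at least `r + dⱼ - dᵢ` with respect to the
weights `a`, that is, for which each monomial of `Λⱼᵢ yᵢ eⱼ`, where `yᵢ` has weight `dᵢ`, has degree
at least `r`. -/
def matrixFiltration (F : Type*) [Field F] {n m : ℕ} (a : Fin n → ℕ) (d : Fin m → ℕ) (r : ℕ) :
    Submodule (MvPowerSeries (Fin n) F) (Matrix (Fin m) (Fin m) (MvPowerSeries (Fin n) F)) where
  carrier := {Λ | ∀ j i, ((r + d j : ℕ) : ℕ∞) ≤ (Λ j i).weightedOrder a + (d i : ℕ∞)}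
  zero_mem' := fun j i => by simp
  add_mem' := fun {A B} hA hB j i => by
    refine (le_min (hA j i) (hB j i)).trans ?_
    rw [min_add_add_right]
    gcongr
    exact min_weightedOrder_le_add a
  smul_mem' := fun c A hA j i => by
    refine (hA j i).trans ?_
    gcongr
    exact le_add_self.trans (le_weightedOrder_mul a (f := c) (g := A j i))

/-- The tangent image at `f` of the orbit of `f` under the filtered contact group `F^r_{a,d} 𝒦`:
the vectors `Λ f + ∑ⱼ ξⱼ ∂f/∂xⱼ`, with `Λ` in `matrixFiltration F a d r`, and with
`ξ ∈ F^r_{a,a} R^n` (each `ξⱼ` then lies in `𝔪` because the weights are positive). -/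
def tangentImage {F : Type*} [Field F] {n m : ℕ} (a : Fin n → ℕ) (d : Fin m → ℕ) (r : ℕ)
    (f : Fin m → MvPowerSeries (Fin n) F) :
    Submodule (MvPowerSeries (Fin n) F) (Fin m → MvPowerSeries (Fin n) F) where
  carrier := {w | ∃ Λ ∈ matrixFiltration F a d r, ∃ ξ ∈ weightFiltration F a a r,
    w = Λ.mulVec f + (jacobian f).mulVec ξ}
  zero_mem' := ⟨0, zero_mem _, 0, zero_mem _, by simp⟩
  add_mem' := by
    rintro _ _ ⟨A, hA, ξ, hξ, rfl⟩ ⟨B, hB, η, hη, rfl⟩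
    refine ⟨A + B, add_mem hA hB, ξ + η, add_mem hξ hη, ?_⟩
    rw [Matrix.add_mulVec, Matrix.mulVec_add]
    abel
  smul_mem' := by
    rintro c _ ⟨A, hA, ξ, hξ, rfl⟩
    refine ⟨c • A, Submodule.smul_mem _ c hA, c • ξ, Submodule.smul_mem _ c hξ, ?_⟩
    rw [Matrix.smul_mulVec, Matrix.mulVec_smul, smul_add]

end

end ContactGeometry

/-! In positive characteristic one cannot integrate vector fields along the segment from `f` to `g`,
and orbit maps may be inseparable. The proof uses tangent data at `f` only, where weighted
homogeneity helps: the series `c^(-r-dᵢ) gᵢ(c^{a₁}x₁, …, c^{aₙ}xₙ)` are contact equivalent to `g`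
for `c ≠ 0` and specialise to `f` at `c = 0`.

Modulo high order, `T` is cut out by finitely many linear equations. The covering hypothesis
provides tangent vectors at `f` dual to them, given by pairs `(Λₗ, ξₗ)`. Acting on the scaled `g`
with `1 + ∑ xₗ Λₗ` and `x ↦ x + ∑ xₗ ξₗ`, and asking that the result lie in `f + T` up to high
order, gives polynomial equations in `c` and the `xₗ`. They vanish at the origin and have identity
Jacobian in the `xₗ` (`familySeries_single_eps`). Hence they have a formal solution with `c` as
parameter, and by the Nullstellensatz a solution over `F` with `c ≠ 0`
(`exists_solution_param_ne_zero`).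

The remaining high order error is absorbed by finite determinacy: the ICIS condition puts all
vectors of large order into the tangent image, compatibly with the filtration
(`exists_weightFiltration_le_tangentImage`), and a successive approximation turns this into contact
equivalence (`contactEquiv_add_of_le_tangentImage`). -/

namespace ContactGeometry

/-! ### Weighted order, substitution and Taylor expansion. -/

section Order

variable {A : Type*} [CommRing A] {n : ℕ} {a : Fin n → ℕ}

/-- The ideal of power series all of whose monomials have weight at least `p`. -/
def ordIdeal (A : Type*) [CommRing A] {n : ℕ} (a : Fin n → ℕ) (p : ℕ) :
    Ideal (MvPowerSeries (Fin n) A) where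
  carrier := {h | (p : ℕ∞) ≤ h.weightedOrder a}
  zero_mem' := by simp
  add_mem' := fun hh hk => (le_min hh hk).trans (min_weightedOrder_le_add a)
  smul_mem' := fun c h hh =>
    (hh.trans le_add_self).trans (le_weightedOrder_mul a (f := c) (g := h))

theorem mem_ordIdeal {p : ℕ} {h : MvPowerSeries (Fin n) A} :
    h ∈ ordIdeal A a p ↔ (p : ℕ∞) ≤ h.weightedOrder a := Iff.rfl

theorem mem_ordIdeal_iff_coeff {p : ℕ} {h : MvPowerSeries (Fin n) A} :
    h ∈ ordIdeal A a p ↔ ∀ α, Finsupp.weight a α < p → coeff α h = 0 :=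
  ⟨fun hh α hα => coeff_eq_zero_of_lt_weightedOrder a ((by exact_mod_cast hα : _ < (p : ℕ∞)).trans_le hh),
    fun hh => nat_le_weightedOrder a hh⟩

theorem ordIdeal_anti {p q : ℕ} (hpq : p ≤ q) : ordIdeal A a q ≤ ordIdeal A a p :=
  fun _ hh => (by exact_mod_cast hpq : (p : ℕ∞) ≤ q).trans hh

theorem mem_ordIdeal_zero (h : MvPowerSeries (Fin n) A) : h ∈ ordIdeal A a 0 := by
  simp [mem_ordIdeal]

theorem mul_mem_ordIdeal {p q : ℕ} {h k : MvPowerSeries (Fin n) A}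
    (hh : h ∈ ordIdeal A a p) (hk : k ∈ ordIdeal A a q) : h * k ∈ ordIdeal A a (p + q) := by
  rw [mem_ordIdeal] at *
  push_cast
  exact (add_le_add hh hk).trans (le_weightedOrder_mul a)

theorem mul_mem_ordIdeal_of_le {p q s : ℕ} {h k : MvPowerSeries (Fin n) A}
    (hh : h ∈ ordIdeal A a p) (hk : k ∈ ordIdeal A a q) (hs : s ≤ p + q) :
    h * k ∈ ordIdeal A a s := ordIdeal_anti hs (mul_mem_ordIdeal hh hk)

theorem smul_mem_ordIdeal {p : ℕ} (c : A) {h : MvPowerSeries (Fin n) A}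
    (hh : h ∈ ordIdeal A a p) : c • h ∈ ordIdeal A a p := by
  rw [smul_eq_C_mul]; exact Ideal.mul_mem_left _ _ hh

theorem monomial_mem_ordIdeal (α : Fin n →₀ ℕ) (c : A) {p : ℕ} (hp : p ≤ Finsupp.weight a α) :
    monomial α c ∈ ordIdeal A a p := by
  classical
  rw [mem_ordIdeal_iff_coeff]
  intro β hβ
  rw [coeff_monomial, if_neg]
  rintro rfl
  omega

theorem X_mem_ordIdeal (j : Fin n) : (X j : MvPowerSeries (Fin n) A) ∈ ordIdeal A a (a j) :=
  monomial_mem_ordIdeal _ _ (by simp [Finsupp.weight_single])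

theorem map_mem_ordIdeal {B : Type*} [CommRing B] (θ : A →+* B) {p : ℕ}
    {h : MvPowerSeries (Fin n) A} (hh : h ∈ ordIdeal A a p) :
    MvPowerSeries.map θ h ∈ ordIdeal B a p := by
  rw [mem_ordIdeal_iff_coeff] at *
  intro α hα
  rw [coeff_map, hh α hα, map_zero]

theorem eq_zero_of_forall_mem_ordIdeal {h : MvPowerSeries (Fin n) A}
    (hh : ∀ p, h ∈ ordIdeal A a p) : h = 0 := by
  ext α
  exact mem_ordIdeal_iff_coeff.1 (hh (Finsupp.weight a α + 1)) α (Nat.lt_succ_self _)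

theorem constantCoeff_eq_zero_of_mem_ordIdeal {p : ℕ} (hp : 0 < p) {h : MvPowerSeries (Fin n) A}
    (hh : h ∈ ordIdeal A a p) : constantCoeff h = 0 := by
  rw [← coeff_zero_eq_constantCoeff_apply]
  exact mem_ordIdeal_iff_coeff.1 hh 0 (by simpa using hp)

/-- A linear map that respects the filtration by order is controlled by its values on monomials. -/
theorem map_mem_ordIdeal_of_monomial (ha : ∀ j, 0 < a j)
    (Φ : MvPowerSeries (Fin n) A →ₗ[A] MvPowerSeries (Fin n) A)
    (hΦ : ∀ N, ∀ h ∈ ordIdeal A a N, Φ h ∈ ordIdeal A a N) {p q : ℕ}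
    (hmon : ∀ α, p ≤ Finsupp.weight a α → Φ (monomial α 1) ∈ ordIdeal A a q)
    {h : MvPowerSeries (Fin n) A} (hh : h ∈ ordIdeal A a p) : Φ h ∈ ordIdeal A a q := by
  classical
  -- Positive weights leave finitely many monomials of weight at most `q`, so modulo order `q` the
  -- series is a polynomial. The hypothesis `hΦ` plays the role of continuity of `Φ`.
  have hfin : {α : Fin n →₀ ℕ | Finsupp.weight a α ≤ q}.Finite :=
    Finsupp.finite_of_nat_weight_le a (fun j => (ha j).ne') q
  set P : MvPowerSeries (Fin n) A := ∑ α ∈ hfin.toFinset, coeff α h • monomial α 1 with hP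
  have hrest : h - P ∈ ordIdeal A a q := by
    rw [mem_ordIdeal_iff_coeff]
    intro β hβ
    rw [hP, map_sub, map_sum, Finset.sum_eq_single β]
    · simp
    · intro α _ hne
      simp [coeff_monomial, Ne.symm hne]
    · intro hβ'
      simp only [Set.Finite.mem_toFinset, Set.mem_ofPred_eq, not_le] at hβ'
      omega
  have hΦP : Φ P ∈ ordIdeal A a q := by
    rw [hP, map_sum]
    refine Ideal.sum_mem _ fun α _ => ?_
    rw [map_smul]
    by_cases hα : p ≤ Finsupp.weight a α
    · exact smul_mem_ordIdeal _ (hmon α hα)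
    · rw [mem_ordIdeal_iff_coeff.1 hh α (not_le.1 hα), zero_smul]
      exact zero_mem _
  have : Φ h = Φ (h - P) + Φ P := by rw [← map_add, sub_add_cancel]
  rw [this]
  exact add_mem (hΦ q _ hrest) hΦP

/-- Multiplicative induction on exponents. -/
theorem exponent_induction {P : (Fin n →₀ ℕ) → Prop} (h0 : P 0)
    (hadd : ∀ α β, P α → P β → P (α + β)) (hX : ∀ j, P (Finsupp.single j 1)) (α) : P α := by
  induction α using Finsupp.induction_linear with
  | zero => exact h0
  | add α β hα hβ => exact hadd α β hα hβ
  | single j k =>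
    induction k with
    | zero => simpa using h0
    | succ k ih => rw [Finsupp.single_add]; exact hadd _ _ ih (hX j)

theorem hasSubst_of_mem_ordIdeal (ha : ∀ j, 0 < a j) {b : Fin n → MvPowerSeries (Fin n) A}
    (hb : ∀ j, b j ∈ ordIdeal A a (a j)) : HasSubst b :=
  hasSubst_of_constantCoeff_zero fun j => constantCoeff_eq_zero_of_mem_ordIdeal (ha j) (hb j)

/-- Each `b j` has at least the order of the variable it replaces, so `b^α` has order at least the
weight of `α`. -/
theorem subst_mem_ordIdeal (ha : ∀ j, 0 < a j) {b : Fin n → MvPowerSeries (Fin n) A}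
    (hb : ∀ j, b j ∈ ordIdeal A a (a j)) {p : ℕ} {h : MvPowerSeries (Fin n) A}
    (hh : h ∈ ordIdeal A a p) : subst b h ∈ ordIdeal A a p := by
  have hs := hasSubst_of_mem_ordIdeal ha hb
  have hprod : ∀ α : Fin n →₀ ℕ, (α.prod fun j e => b j ^ e) ∈
      ordIdeal A a (Finsupp.weight a α) := by
    intro α
    induction α using exponent_induction with
    | h0 => simpa using mem_ordIdeal_zero _
    | hadd α β hα hβ =>
      rw [Finsupp.prod_add_index' (by simp) (by intros; rw [pow_add]), map_add]
      exact mul_mem_ordIdeal hα hβ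
    | hX j => simpa [Finsupp.weight_single] using hb j
  rw [mem_ordIdeal_iff_coeff]
  intro β hβ
  rw [coeff_subst hs, finsum_eq_zero_of_forall_eq_zero]
  intro α
  by_cases hα : p ≤ Finsupp.weight a α
  · rw [mem_ordIdeal_iff_coeff.1 (hprod α) β (by omega), smul_zero]
  · rw [mem_ordIdeal_iff_coeff.1 hh α (by omega), zero_smul]

theorem monomial_add_one (α β : Fin n →₀ ℕ) :
    (monomial (α + β) 1 : MvPowerSeries (Fin n) A) = monomial α 1 * monomial β 1 := by
  rw [monomial_mul_monomial, one_mul]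

theorem monomial_one_mem (α : Fin n →₀ ℕ) :
    (monomial α 1 : MvPowerSeries (Fin n) A) ∈ ordIdeal A a (Finsupp.weight a α) :=
  monomial_mem_ordIdeal _ _ le_rfl

/-- On monomials this follows by telescoping products; linearity and finiteness modulo each order
extend it to series. -/
theorem subst_sub_subst_mem (ha : ∀ j, 0 < a j) {b c : Fin n → MvPowerSeries (Fin n) A} {s : ℕ}
    (hb : ∀ j, b j ∈ ordIdeal A a (a j)) (hc : ∀ j, c j ∈ ordIdeal A a (a j))
    (hbc : ∀ j, b j - c j ∈ ordIdeal A a (a j + s)) {p : ℕ} {h : MvPowerSeries (Fin n) A}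
    (hh : h ∈ ordIdeal A a p) : subst b h - subst c h ∈ ordIdeal A a (p + s) := by
  have hsb := hasSubst_of_mem_ordIdeal ha hb
  have hsc := hasSubst_of_mem_ordIdeal ha hc
  have key : ∀ α : Fin n →₀ ℕ, subst b (monomial α (1 : A)) - subst c (monomial α (1 : A)) ∈
      ordIdeal A a (Finsupp.weight a α + s) := by
    intro α
    induction α using exponent_induction with
    | h0 =>
      have : (monomial 0 (1 : A) : MvPowerSeries (Fin n) A) = 1 := rfl
      rw [this, ← substAlgHom_apply hsb, ← substAlgHom_apply hsc, map_one, map_one, sub_self]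
      exact zero_mem _
    | hadd α β hα hβ =>
      rw [monomial_add_one, subst_mul hsb, subst_mul hsc, map_add]
      set x := subst b (monomial α (1 : A))
      set y := subst b (monomial β (1 : A)) with hy
      set u := subst c (monomial α (1 : A)) with hu
      set v := subst c (monomial β (1 : A))
      rw [show x * y - u * v = (x - u) * y + u * (y - v) by ring]
      exact add_mem
        (mul_mem_ordIdeal_of_le hα (subst_mem_ordIdeal ha hb (monomial_one_mem β)) (by omega))
        (mul_mem_ordIdeal_of_le (subst_mem_ordIdeal ha hc (monomial_one_mem α)) hβ (by omega))
    | hX j =>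
      rw [show (monomial (Finsupp.single j 1) (1 : A) : MvPowerSeries (Fin n) A) = X j from rfl,
        subst_X hsb, subst_X hsc]
      simpa [Finsupp.weight_single] using hbc j
  have := map_mem_ordIdeal_of_monomial (p := p) (q := p + s) ha
    ((substAlgHom hsb).toLinearMap - (substAlgHom hsc).toLinearMap)
    (fun N h hh => by
      simpa using sub_mem (subst_mem_ordIdeal ha hb hh) (subst_mem_ordIdeal ha hc hh))
    (fun α hα => by
      simpa using ordIdeal_anti (by omega) (key α)) hh
  simpa using this

/-- Differentiating by `x j` costs at most `a j` in order, which the factor `δ` gives back. -/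
theorem mul_pderiv_mem (j : Fin n) {s p : ℕ} {δ h : MvPowerSeries (Fin n) A}
    (hδ : δ ∈ ordIdeal A a (a j + s)) (hh : h ∈ ordIdeal A a p) :
    δ * pderiv A j h ∈ ordIdeal A a (p + s) := by
  have : pderiv A j h ∈ ordIdeal A a (p - a j) := by
    rw [mem_ordIdeal_iff_coeff] at *
    intro α hα
    rw [coeff_pderiv, hh, zero_mul]
    rw [map_add, Finsupp.weight_single]
    simp only [smul_eq_mul, one_mul]
    omega
  exact mul_mem_ordIdeal_of_le hδ this (by omega)

/-- The derivation `∑ⱼ δⱼ ∂/∂xⱼ`. -/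
noncomputable def vectorField (δ : Fin n → MvPowerSeries (Fin n) A) :
    Derivation A (MvPowerSeries (Fin n) A) (MvPowerSeries (Fin n) A) :=
  ∑ j, δ j • pderiv A j

theorem vectorField_apply (δ : Fin n → MvPowerSeries (Fin n) A) (h : MvPowerSeries (Fin n) A) :
    vectorField δ h = ∑ j, δ j * pderiv A j h := by
  have : vectorField δ h = (∑ j, Derivation.coeFnAddMonoidHom (δ j • pderiv A j)) h := by
    rw [← map_sum]; rfl
  rw [this, Finset.sum_apply]
  rfl

theorem vectorField_X (δ : Fin n → MvPowerSeries (Fin n) A) (j : Fin n) :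
    vectorField δ (X j) = δ j := by
  classical
  rw [vectorField_apply, Finset.sum_eq_single j]
  · simp
  · intro i _ hij
    rw [pderiv_X_of_ne hij.symm, mul_zero]
  · simp

theorem vectorField_mem {δ : Fin n → MvPowerSeries (Fin n) A} {s p : ℕ}
    (hδ : ∀ j, δ j ∈ ordIdeal A a (a j + s)) {h : MvPowerSeries (Fin n) A}
    (hh : h ∈ ordIdeal A a p) : vectorField δ h ∈ ordIdeal A a (p + s) := by
  rw [vectorField_apply]
  exact Ideal.sum_mem _ fun j _ => mul_pderiv_mem j (hδ j) hh

/-- First order Taylor expansion with respect to the filtration by order. -/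
theorem subst_add_sub_subst_sub_vectorField_mem (ha : ∀ j, 0 < a j)
    {ξ δ : Fin n → MvPowerSeries (Fin n) A} {s : ℕ} (hs : 1 ≤ s)
    (hξ : ∀ j, ξ j ∈ ordIdeal A a (a j + 1)) (hδ : ∀ j, δ j ∈ ordIdeal A a (a j + s))
    {p : ℕ} {h : MvPowerSeries (Fin n) A} (hh : h ∈ ordIdeal A a p) :
    subst (fun j => X j + (ξ j + δ j)) h - subst (fun j => X j + ξ j) h - vectorField δ h ∈
      ordIdeal A a (p + s + 1) := by
  have hδ1 : ∀ j, δ j ∈ ordIdeal A a (a j + 1) := fun j => ordIdeal_anti (by omega) (hδ j)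
  have hX : ∀ j, (X j : MvPowerSeries (Fin n) A) ∈ ordIdeal A a (a j) := X_mem_ordIdeal
  have hc : ∀ j, X j + ξ j ∈ ordIdeal A a (a j) := fun j =>
    add_mem (hX j) (ordIdeal_anti (by omega) (hξ j))
  have hb : ∀ j, X j + (ξ j + δ j) ∈ ordIdeal A a (a j) := fun j =>
    add_mem (hX j) (ordIdeal_anti (by omega) (add_mem (hξ j) (hδ1 j)))
  have hsb := hasSubst_of_mem_ordIdeal ha hb
  have hsc := hasSubst_of_mem_ordIdeal ha hc
  have hbX : ∀ {q : ℕ} {k : MvPowerSeries (Fin n) A}, k ∈ ordIdeal A a q →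
      subst (fun j => X j + (ξ j + δ j)) k - k ∈ ordIdeal A a (q + 1) := by
    intro q k hk
    have := subst_sub_subst_mem ha hb hX (s := 1)
      (fun j => by simpa using add_mem (hξ j) (hδ1 j)) hk
    simpa only [subst_self, id] using this
  have hcX : ∀ {q : ℕ} {k : MvPowerSeries (Fin n) A}, k ∈ ordIdeal A a q →
      subst (fun j => X j + ξ j) k - k ∈ ordIdeal A a (q + 1) := by
    intro q k hk
    have := subst_sub_subst_mem ha hc hX (s := 1) (fun j => by simpa using hξ j) hk
    simpa only [subst_self, id] using this
  have key : ∀ α : Fin n →₀ ℕ, subst (fun j => X j + (ξ j + δ j)) (monomial α (1 : A)) -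
      subst (fun j => X j + ξ j) (monomial α (1 : A)) - vectorField δ (monomial α (1 : A)) ∈
      ordIdeal A a (Finsupp.weight a α + s + 1) := by
    intro α
    induction α using exponent_induction with
    | h0 =>
      have : (monomial 0 (1 : A) : MvPowerSeries (Fin n) A) = 1 := rfl
      rw [this, ← substAlgHom_apply hsb, ← substAlgHom_apply hsc, map_one, map_one, sub_self,
        Derivation.map_one_eq_zero, sub_zero]
      exact zero_mem _
    | hadd α β hα hβ =>
      have h1 := hbX (monomial_one_mem (A := A) (a := a) β)
      have h2 := hcX (monomial_one_mem (A := A) (a := a) α)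
      have h3 := vectorField_mem hδ (monomial_one_mem (A := A) (a := a) α)
      have h4 := vectorField_mem hδ (monomial_one_mem (A := A) (a := a) β)
      have h5 := subst_mem_ordIdeal ha hb (monomial_one_mem (A := A) (a := a) β)
      have h6 := subst_mem_ordIdeal ha hc (monomial_one_mem (A := A) (a := a) α)
      rw [monomial_add_one, subst_mul hsb, subst_mul hsc, map_add, Derivation.leibniz]
      simp only [smul_eq_mul]
      set m₁ := (monomial α (1 : A) : MvPowerSeries (Fin n) A)
      set m₂ := (monomial β (1 : A) : MvPowerSeries (Fin n) A)
      set x := subst (fun j => X j + (ξ j + δ j)) m₁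
      set y := subst (fun j => X j + (ξ j + δ j)) m₂
      set u := subst (fun j => X j + ξ j) m₁
      set v := subst (fun j => X j + ξ j) m₂
      -- The first two terms carry the inductive errors. In the last two, a first order term of gain
      -- `s` meets a difference of gain 1; this is where `ξ` must raise weights strictly. No
      -- factorials are inverted.
      rw [show x * y - u * v - (m₁ * vectorField δ m₂ + m₂ * vectorField δ m₁) =
        (x - u - vectorField δ m₁) * y + u * (y - v - vectorField δ m₂) +
          vectorField δ m₁ * (y - m₂) + (u - m₁) * vectorField δ m₂ by ring]
      refine add_mem (add_mem (add_mem ?_ ?_) ?_) ?_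
      · exact mul_mem_ordIdeal_of_le hα h5 (by omega)
      · exact mul_mem_ordIdeal_of_le h6 hβ (by omega)
      · exact mul_mem_ordIdeal_of_le h3 h1 (by omega)
      · exact mul_mem_ordIdeal_of_le h2 h4 (by omega)
    | hX j =>
      rw [show (monomial (Finsupp.single j 1) (1 : A) : MvPowerSeries (Fin n) A) = X j from rfl,
        subst_X hsb, subst_X hsc, vectorField_X]
      simp
  have := map_mem_ordIdeal_of_monomial (p := p) (q := p + s + 1) ha
    ((substAlgHom hsb).toLinearMap - (substAlgHom hsc).toLinearMap - (vectorField δ).toLinearMap)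
    (fun N h hh => by
      simpa using sub_mem (sub_mem (subst_mem_ordIdeal ha hb hh) (subst_mem_ordIdeal ha hc hh))
        (ordIdeal_anti (by omega) (vectorField_mem hδ hh)))
    (fun α hα => by
      simpa using ordIdeal_anti (by omega) (key α)) hh
  simpa using this

/-- The exact first order Taylor expansion in the direction of a parameter of square zero. -/
theorem subst_X_add_smul_of_sq_eq_zero (ha : ∀ j, 0 < a j) {c : A} (hc : c * c = 0)
    {ξ : Fin n → MvPowerSeries (Fin n) A} (hξ : ∀ j, ξ j ∈ ordIdeal A a (a j))
    (h : MvPowerSeries (Fin n) A) :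
    subst (fun j => X j + c • ξ j) h = h + c • vectorField ξ h := by
  have hb : ∀ j, X j + c • ξ j ∈ ordIdeal A a (a j) := fun j =>
    add_mem (X_mem_ordIdeal j) (smul_mem_ordIdeal c (hξ j))
  have hsb := hasSubst_of_mem_ordIdeal ha hb
  have key : ∀ α : Fin n →₀ ℕ, subst (fun j => X j + c • ξ j) (monomial α (1 : A)) =
      monomial α (1 : A) + c • vectorField ξ (monomial α (1 : A)) := by
    intro α
    induction α using exponent_induction with
    | h0 =>
      have : (monomial 0 (1 : A) : MvPowerSeries (Fin n) A) = 1 := rfl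
      rw [this, ← substAlgHom_apply hsb, map_one, Derivation.map_one_eq_zero, smul_zero, add_zero]
    | hadd α β hα hβ =>
      have hC : (C c : MvPowerSeries (Fin n) A) * C c = 0 := by rw [← map_mul, hc, map_zero]
      rw [monomial_add_one, subst_mul hsb, hα, hβ, Derivation.leibniz]
      simp only [smul_eq_mul, smul_eq_C_mul]
      linear_combination
        (vectorField ξ (monomial α (1 : A)) * vectorField ξ (monomial β (1 : A))) * hC
    | hX j =>
      rw [show (monomial (Finsupp.single j 1) (1 : A) : MvPowerSeries (Fin n) A) = X j from rfl,
        subst_X hsb, vectorField_X]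
  -- The difference of both sides kills all monomials, so it maps every series into every order
  -- ideal.
  have := eq_zero_of_forall_mem_ordIdeal (fun q => map_mem_ordIdeal_of_monomial (p := 0) (q := q) ha
    ((substAlgHom hsb).toLinearMap - LinearMap.id - c • (vectorField ξ).toLinearMap)
    (fun N h hh => by
      simpa using sub_mem (sub_mem (subst_mem_ordIdeal ha hb hh) hh)
        (smul_mem_ordIdeal c (vectorField_mem (s := 0) hξ hh)))
    (fun α _ => by simp [key α]) (mem_ordIdeal_zero h))
  simp only [LinearMap.sub_apply, AlgHom.toLinearMap_apply, substAlgHom_apply, LinearMap.id_apply,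
    LinearMap.smul_apply, Derivation.coeFn_coe] at this
  linear_combination this

/-- Completeness with respect to the filtration by order. -/
theorem exists_limit (u : ℕ → MvPowerSeries (Fin n) A) (b : ℕ → ℕ) (hb : Monotone b)
    (hb' : ∀ p, ∃ k, p < b k) (hu : ∀ k, u (k + 1) - u k ∈ ordIdeal A a (b k)) :
    ∃ v, ∀ k, v - u k ∈ ordIdeal A a (b k) := by
  choose κ hκ using hb'
  have hdiff : ∀ k l, k ≤ l → u l - u k ∈ ordIdeal A a (b k) := by
    intro k l hkl
    induction l, hkl using Nat.le_induction with
    | base => simp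
    | succ l hkl ih =>
      have := add_mem (ordIdeal_anti (hb hkl) (hu l)) ih
      simpa using this
  -- Each coefficient is read off at a stage from which it no longer changes.
  let v : MvPowerSeries (Fin n) A := fun α => coeff α (u (κ (Finsupp.weight a α)))
  have hv : ∀ α, coeff α v = coeff α (u (κ (Finsupp.weight a α))) := fun α => coeff_apply v α
  refine ⟨v, fun k => ?_⟩
  rw [mem_ordIdeal_iff_coeff]
  intro α hα
  rw [map_sub, sub_eq_zero, hv]
  rcases le_total k (κ (Finsupp.weight a α)) with hk | hk
  · have := mem_ordIdeal_iff_coeff.1 (hdiff _ _ hk) α hα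
    rwa [map_sub, sub_eq_zero] at this
  · have := mem_ordIdeal_iff_coeff.1 (hdiff _ _ hk) α (hκ _)
    rw [map_sub, sub_eq_zero] at this
    exact this.symm

end Order

/-! ### The filtered contact group. -/

section Group

variable {F : Type*} [Field F] {n m : ℕ} {a : Fin n → ℕ} {d : Fin m → ℕ}

theorem ContactEquiv.trans {f g h : Fin m → MvPowerSeries (Fin n) F}
    (hfg : ContactEquiv f g) (hgh : ContactEquiv g h) : ContactEquiv f h := by
  obtain ⟨U, φ, rfl⟩ := hfg
  obtain ⟨V, ψ, rfl⟩ := hgh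
  refine ⟨V * Matrix.GeneralLinearGroup.map (ψ : _ →+* MvPowerSeries (Fin n) F) U,
    φ.trans ψ, ?_⟩
  rw [Units.val_mul, ← Matrix.mulVec_mulVec]
  congr 1
  ext1 i
  simp [Matrix.mulVec, dotProduct]

theorem mem_weightFiltration {r : ℕ} {h : Fin m → MvPowerSeries (Fin n) F} :
    h ∈ weightFiltration F a d r ↔ ∀ i, h i ∈ ordIdeal F a (r + d i) := Iff.rfl

/-- The subtraction is truncated: the condition is void when `d i` exceeds `r + d j`. -/
theorem mem_matrixFiltration {r : ℕ} {Λ : Matrix (Fin m) (Fin m) (MvPowerSeries (Fin n) F)} :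
    Λ ∈ matrixFiltration F a d r ↔ ∀ j i, Λ j i ∈ ordIdeal F a (r + d j - d i) := by
  refine forall₂_congr fun j i => ?_
  rw [mem_ordIdeal]
  cases h : (Λ j i).weightedOrder a with
  | top => simp
  | coe w =>
    norm_cast
    omega

theorem weightFiltration_anti {r s : ℕ} (hrs : r ≤ s) :
    weightFiltration F a d s ≤ weightFiltration F a d r :=
  fun _ hh i => ordIdeal_anti (by omega) (hh i)

theorem matrixFiltration_anti {r s : ℕ} (hrs : r ≤ s) :
    matrixFiltration F a d s ≤ matrixFiltration F a d r := fun Λ hΛ => by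
  rw [mem_matrixFiltration] at *
  exact fun j i => ordIdeal_anti (by omega) (hΛ j i)

theorem mulVec_mem_weightFiltration {r s : ℕ}
    {Λ : Matrix (Fin m) (Fin m) (MvPowerSeries (Fin n) F)} (hΛ : Λ ∈ matrixFiltration F a d s)
    {h : Fin m → MvPowerSeries (Fin n) F} (hh : h ∈ weightFiltration F a d r) :
    Λ.mulVec h ∈ weightFiltration F a d (r + s) := by
  rw [mem_matrixFiltration] at hΛ
  refine mem_weightFiltration.2 fun j => ?_
  rw [Matrix.mulVec, dotProduct]
  refine Ideal.sum_mem (ordIdeal F a (r + s + d j)) fun i _ => ?_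
  exact mul_mem_ordIdeal_of_le (hΛ j i) (mem_weightFiltration.1 hh i) (by omega)

/-- The constant term of `Λ j i` vanishes whenever `d i ≤ d j`. So the matrix of constant terms of
`1 + Λ` is block triangular for the grading by `d` with identity diagonal blocks, and has
determinant 1. -/
theorem isUnit_one_add {Λ : Matrix (Fin m) (Fin m) (MvPowerSeries (Fin n) F)}
    (hΛ : Λ ∈ matrixFiltration F a d 1) : IsUnit (1 + Λ) := by
  classical
  rw [mem_matrixFiltration] at hΛ
  rw [Matrix.isUnit_iff_isUnit_det, isUnit_iff_constantCoeff, RingHom.map_det]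
  set M : Matrix (Fin m) (Fin m) F := constantCoeff.mapMatrix (1 + Λ) with hM
  have hMij : ∀ j i, d i ≤ d j → M j i = (1 : Matrix (Fin m) (Fin m) F) j i := by
    intro j i hij
    have := constantCoeff_eq_zero_of_mem_ordIdeal (by omega) (hΛ j i)
    rw [hM, map_add, map_one, Matrix.add_apply, RingHom.mapMatrix_apply, Matrix.map_apply, this,
      add_zero]
  have htri : M.BlockTriangular d := by
    intro j i hij
    rw [hMij j i hij.le, Matrix.one_apply_ne]
    rintro rfl
    exact lt_irrefl _ hij
  rw [htri.det, Finset.prod_eq_one]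
  · exact isUnit_one
  · intro b _
    have : M.toSquareBlock d b = 1 := by
      ext ⟨j, hj⟩ ⟨i, hi⟩
      rw [Matrix.toSquareBlock_def, Matrix.of_apply, hMij j i (hi.trans hj.symm).le]
      simp [Matrix.one_apply, Subtype.ext_iff]
    rw [this, Matrix.det_one]

theorem X_add_mem {A : Type*} [CommRing A] {ξ : Fin n → MvPowerSeries (Fin n) A}
    (hξ : ∀ j, ξ j ∈ ordIdeal A a (a j)) (j : Fin n) : X j + ξ j ∈ ordIdeal A a (a j) :=
  add_mem (X_mem_ordIdeal j) (hξ j)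

theorem subst_X_add_sub_mem {A : Type*} [CommRing A] (ha : ∀ j, 0 < a j)
    {ξ : Fin n → MvPowerSeries (Fin n) A} {s : ℕ}
    (hξ : ∀ j, ξ j ∈ ordIdeal A a (a j + s)) {p : ℕ} {h : MvPowerSeries (Fin n) A}
    (hh : h ∈ ordIdeal A a p) : subst (fun j => X j + ξ j) h - h ∈ ordIdeal A a (p + s) := by
  have := subst_sub_subst_mem ha (X_add_mem fun j => ordIdeal_anti (by omega) (hξ j))
    X_mem_ordIdeal (s := s) (fun j => by simpa using hξ j) hh
  simpa only [subst_self, id] using this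

theorem mem_weightFiltration_self {s : ℕ} {ξ : Fin n → MvPowerSeries (Fin n) F} :
    ξ ∈ weightFiltration F a a s ↔ ∀ j, ξ j ∈ ordIdeal F a (a j + s) := by
  simp only [mem_weightFiltration, add_comm]

/-- The substitution differs from the identity by an operator that raises order by at least 1. A
kernel element therefore has infinite order, and preimages arise by iterating `v ↦ v + (h - S v)`,
with `S` the substitution. -/
theorem bijective_subst_X_add (ha : ∀ j, 0 < a j) {ξ : Fin n → MvPowerSeries (Fin n) F}
    (hξ : ∀ j, ξ j ∈ ordIdeal F a (a j + 1))
    (hs : HasSubst fun j => (X j + ξ j : MvPowerSeries (Fin n) F)) :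
    Function.Bijective (substAlgHom (R := F) hs) := by
  have hsub : ∀ {p : ℕ} {h : MvPowerSeries (Fin n) F}, h ∈ ordIdeal F a p →
      substAlgHom hs h - h ∈ ordIdeal F a (p + 1) := fun hh => by
    rw [substAlgHom_apply]; exact subst_X_add_sub_mem ha hξ hh
  constructor
  · rw [injective_iff_map_eq_zero]
    intro h hh
    refine eq_zero_of_forall_mem_ordIdeal (a := a) fun p => ?_
    induction p with
    | zero => exact mem_ordIdeal_zero h
    | succ p ih => simpa [hh] using neg_mem (hsub ih)
  · intro h
    let u : ℕ → MvPowerSeries (Fin n) F := fun k =>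
      Nat.rec 0 (fun _ v => v + (h - substAlgHom hs v)) k
    have hu : ∀ k, u (k + 1) = u k + (h - substAlgHom hs (u k)) := fun _ => rfl
    have hres : ∀ k, h - substAlgHom hs (u k) ∈ ordIdeal F a k := by
      intro k
      induction k with
      | zero => exact mem_ordIdeal_zero _
      | succ k ih =>
        rw [hu, map_add]
        convert neg_mem (hsub ih) using 1
        ring
    obtain ⟨v, hv⟩ := exists_limit (a := a) u id monotone_id (fun p => ⟨p + 1, by simp⟩)
      (fun k => by rw [hu]; simpa using hres k)
    refine ⟨v, ?_⟩
    rw [← sub_eq_zero, ← neg_eq_zero, neg_sub]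
    refine eq_zero_of_forall_mem_ordIdeal (a := a) fun k => ?_
    have h1 := hsub (hv k)
    have h2 := add_mem (ordIdeal_anti (Nat.le_succ _) h1) (hv k)
    rw [sub_add_cancel, map_sub] at h2
    convert sub_mem (hres k) h2 using 1
    ring

/-- The action of the element `(1 + Λ, x ↦ x + ξ)` of the filtered contact group. -/
theorem contactEquiv_one_add_mulVec_subst (ha : ∀ j, 0 < a j)
    {Λ : Matrix (Fin m) (Fin m) (MvPowerSeries (Fin n) F)} (hΛ : Λ ∈ matrixFiltration F a d 1)
    {ξ : Fin n → MvPowerSeries (Fin n) F} (hξ : ξ ∈ weightFiltration F a a 1)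
    (k : Fin m → MvPowerSeries (Fin n) F) :
    ContactEquiv k ((1 + Λ).mulVec fun i => subst (fun j => X j + ξ j) (k i)) := by
  rw [mem_weightFiltration_self] at hξ
  have hs := hasSubst_of_mem_ordIdeal ha
    (X_add_mem fun j => ordIdeal_anti (Nat.le_succ _) (hξ j))
  refine ⟨(isUnit_one_add hΛ).unit, AlgEquiv.ofBijective _ (bijective_subst_X_add ha hξ hs), ?_⟩
  simp

theorem contactEquiv_smul_rescale {b : Fin n → F} (hb : ∀ j, b j ≠ 0) {c : Fin m → F}
    (hc : ∀ i, c i ≠ 0) (k : Fin m → MvPowerSeries (Fin n) F) :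
    ContactEquiv k fun i => c i • rescale b (k i) := by
  have h1 : b * b⁻¹ = 1 := by ext j; simp [hb j]
  have h2 : b⁻¹ * b = 1 := by ext j; simp [hb j]
  have hU : IsUnit (Matrix.diagonal fun i => (C (c i) : MvPowerSeries (Fin n) F)) := by
    rw [Matrix.isUnit_diagonal, Pi.isUnit_iff]
    exact fun i => (isUnit_iff_ne_zero.2 (hc i)).map C
  refine ⟨hU.unit, AlgEquiv.ofAlgHom (rescaleAlgHom b) (rescaleAlgHom b⁻¹) ?_ ?_, ?_⟩
  · rw [← rescaleAlgHom_mul, h2, rescaleAlgHom_one]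
  · rw [← rescaleAlgHom_mul, h1, rescaleAlgHom_one]
  · ext1 i
    simp [Matrix.mulVec_diagonal, rescaleAlgHom_apply, smul_eq_C_mul]

end Group

/-! ### The tangent image contains all vectors of large order. -/

section Tangent

variable {F : Type*} [Field F] {n m : ℕ} {a : Fin n → ℕ} {d : Fin m → ℕ}

theorem jacobian_mulVec (f : Fin m → MvPowerSeries (Fin n) F)
    (ξ : Fin n → MvPowerSeries (Fin n) F) (i : Fin m) :
    (jacobian f).mulVec ξ i = vectorField ξ (f i) := by
  rw [vectorField_apply]
  simp only [Matrix.mulVec, dotProduct, jacobian, Matrix.of_apply]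
  exact Finset.sum_congr rfl fun j _ => mul_comm (pderiv F j (f i)) (ξ j)

/-- A power series of large order lies in a given power of the ideal of the variables. -/
theorem ordIdeal_le_varIdeal_pow (k : ℕ) :
    ordIdeal F a (k * (∑ j, a j + 1)) ≤ varIdeal F n ^ k := by
  classical
  induction k with
  | zero => simp
  | succ k ih =>
    intro h hh
    have hcoeff := mem_ordIdeal_iff_coeff.1 hh
    -- the part of `h` consisting of the monomials whose first variable is `x j`
    let φ : (Fin n →₀ ℕ) → Option (Fin n) := fun α => (List.finRange n).find? (fun j => α j ≠ 0)
    let q : Fin n → MvPowerSeries (Fin n) F := fun j γ =>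
      if φ (γ + Finsupp.single j 1) = some j then coeff (γ + Finsupp.single j 1) h else 0
    have hq : ∀ j γ, coeff γ (q j) =
        if φ (γ + Finsupp.single j 1) = some j then coeff (γ + Finsupp.single j 1) h else 0 :=
      fun j γ => coeff_apply (q j) γ
    have hsum : h = ∑ j, X j * q j := by
      ext α
      rw [map_sum]
      have hterm : ∀ j, coeff α (X j * q j) = if φ α = some j then coeff α h else 0 := by
        intro j
        rw [X_def, coeff_monomial_mul]
        by_cases hj : α j = 0
        · have hφ : φ α ≠ some j := by
            intro hφ
            have := List.find?_some hφ
            simp [hj] at this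
          rw [if_neg hφ]
          simp [hj]
        · have hle : Finsupp.single j 1 ≤ α := by
            rw [Finsupp.single_le_iff]; omega
          rw [if_pos hle, one_mul, hq, tsub_add_cancel_of_le hle]
      simp only [hterm]
      cases hφ : φ α with
      | some j => simp
      | none =>
        have h0 : α = 0 := by
          ext j
          have := List.find?_eq_none.1 hφ j (List.mem_finRange j)
          simpa using this
        simp only [reduceCtorEq, if_false, Finset.sum_const_zero]
        refine hcoeff α ?_
        rw [h0, map_zero]
        positivity
    rw [hsum]
    refine Ideal.sum_mem _ fun j _ => ?_
    rw [pow_succ']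
    refine Ideal.mul_mem_mul (Ideal.subset_span ⟨j, rfl⟩) (ih ?_)
    rw [mem_ordIdeal_iff_coeff]
    intro γ hγ
    rw [hq]
    split_ifs with hφ
    · refine hcoeff _ ?_
      -- Splitting off one variable lowers the weight by at most `∑ a j`, which explains the factor
      -- multiplying `k`.
      have haj : a j ≤ ∑ j, a j := Finset.single_le_sum (fun _ _ => Nat.zero_le _) (Finset.mem_univ j)
      rw [map_add, Finsupp.weight_single, smul_eq_mul, one_mul, Nat.succ_mul]
      omega
    · rfl

/-- The full tangent module `{Λ f + ∑ ξⱼ ∂f/∂xⱼ}`. -/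
def fullTangent (f : Fin m → MvPowerSeries (Fin n) F) :
    Submodule (MvPowerSeries (Fin n) F) (Fin m → MvPowerSeries (Fin n) F) where
  carrier := {w | ∃ (Λ : Matrix (Fin m) (Fin m) (MvPowerSeries (Fin n) F))
    (ξ : Fin n → MvPowerSeries (Fin n) F), w = Λ.mulVec f + (jacobian f).mulVec ξ}
  zero_mem' := ⟨0, 0, by simp⟩
  add_mem' := by
    rintro _ _ ⟨A, ξ, rfl⟩ ⟨B, η, rfl⟩
    exact ⟨A + B, ξ + η, by rw [Matrix.add_mulVec, Matrix.mulVec_add]; abel⟩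
  smul_mem' := by
    rintro c _ ⟨A, ξ, rfl⟩
    exact ⟨c • A, c • ξ, by rw [Matrix.smul_mulVec, Matrix.mulVec_smul, smul_add]⟩

/-- For a component of `f`, put `v` into the matching column of `Λ`. For a minor `det M`, Cramer's
rule `det M • v = M (adj M v)` yields a vector field supported on the chosen columns. -/
theorem smul_mem_fullTangent {f : Fin m → MvPowerSeries (Fin n) F} {c : MvPowerSeries (Fin n) F}
    (hc : c ∈ Ideal.span (Set.range f) ⊔ jacobianMinors f)
    (v : Fin m → MvPowerSeries (Fin n) F) : c • v ∈ fullTangent f := by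
  classical
  have hle : Ideal.span (Set.range f) ⊔ jacobianMinors f ≤
      (fullTangent f).comap (LinearMap.toSpanSingleton _ _ v) := by
    refine sup_le (Ideal.span_le.2 ?_) (Ideal.span_le.2 ?_)
    · rintro _ ⟨i, rfl⟩
      refine ⟨Matrix.of fun k l => if l = i then v k else 0, 0, ?_⟩
      ext1 k
      simp [Matrix.mulVec, dotProduct, mul_comm]
    · rintro _ ⟨e, rfl⟩
      set M := (jacobian f).submatrix id e with hM
      refine ⟨0, fun j => ∑ l, if e l = j then M.adjugate.mulVec v l else 0, ?_⟩
      have hv : M.det • v = M.mulVec (M.adjugate.mulVec v) := by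
        rw [Matrix.mulVec_mulVec, Matrix.mul_adjugate, Matrix.smul_mulVec, Matrix.one_mulVec]
      simp only [LinearMap.toSpanSingleton_apply, Matrix.zero_mulVec, zero_add]
      rw [hv]
      generalize M.adjugate.mulVec v = w
      ext1 i
      simp only [Matrix.mulVec, dotProduct, Finset.mul_sum, hM]
      rw [Finset.sum_comm]
      simp
  exact hle hc

/-- The part of a power series consisting of the monomials of weight at least `q`. -/
noncomputable def highPart (a : Fin n → ℕ) (q : ℕ) (c : MvPowerSeries (Fin n) F) : MvPowerSeries (Fin n) F :=
  fun α => if q ≤ Finsupp.weight a α then coeff α c else 0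

theorem coeff_highPart (q : ℕ) (c : MvPowerSeries (Fin n) F) (α : Fin n →₀ ℕ) :
    coeff α (highPart a q c) = if q ≤ Finsupp.weight a α then coeff α c else 0 :=
  coeff_apply (highPart a q c) α

theorem highPart_mem (q : ℕ) (c : MvPowerSeries (Fin n) F) :
    highPart a q c ∈ ordIdeal F a q := by
  rw [mem_ordIdeal_iff_coeff]
  intro α hα
  rw [coeff_highPart, if_neg (by omega)]

/-- Multiplication by a weighted homogeneous series of weight `w - b` respects weights. -/
theorem coeff_highPart_mul {f : MvPowerSeries (Fin n) F} {b w : ℕ}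
    (hf : ∀ γ, coeff γ f ≠ 0 → Finsupp.weight a γ + b = w) (q : ℕ) (c : MvPowerSeries (Fin n) F)
    {β : Fin n →₀ ℕ} (hβ : q = 0 ∨ q + w ≤ Finsupp.weight a β + b) :
    coeff β (highPart a q c * f) = coeff β (c * f) := by
  classical
  rw [coeff_mul, coeff_mul]
  refine Finset.sum_congr rfl fun x hx => ?_
  rw [coeff_highPart]
  split_ifs with h
  · rfl
  · by_cases hx2 : coeff x.2 f = 0
    · rw [hx2, mul_zero, mul_zero]
    · exfalso
      have h1 := hf _ hx2
      have h2 : Finsupp.weight a x.1 + Finsupp.weight a x.2 = Finsupp.weight a β := by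
        rw [← map_add, Finset.HasAntidiagonal.mem_antidiagonal.1 hx]
      omega

/-- Comparing coefficients gives `t^p = t^q` for all `t` in an infinite field, which forces `p = q`.
-/
theorem IsWeightedHomog.weight_eq [Infinite F] {r : ℕ}
    {f : Fin m → MvPowerSeries (Fin n) F} (hf : IsWeightedHomog a d r f) {i : Fin m}
    {α : Fin n →₀ ℕ} (hα : coeff α (f i) ≠ 0) : Finsupp.weight a α = r + d i := by
  have h : ∀ t : F, t ^ Finsupp.weight a α = t ^ (r + d i) := by
    intro t
    have h1 := congrArg (coeff α) (hf t i)
    rw [coeff_rescale, map_smul, smul_eq_mul] at h1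
    have h2 := mul_right_cancel₀ hα h1
    rw [← h2, Finsupp.weight_apply, Finsupp.sum, Finsupp.prod, ← Finset.prod_pow_eq_pow_sum]
    refine Finset.prod_congr rfl fun j _ => ?_
    rw [← pow_mul, smul_eq_mul, mul_comm]
  have hp : (Polynomial.X ^ Finsupp.weight a α : Polynomial F) = Polynomial.X ^ (r + d i) :=
    Polynomial.funext fun t => by simpa using h t
  simpa using congrArg Polynomial.natDegree hp

theorem mulVec_add_jacobian_mulVec_mem {r s : ℕ}
    {Λ : Matrix (Fin m) (Fin m) (MvPowerSeries (Fin n) F)} (hΛ : Λ ∈ matrixFiltration F a d s)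
    {ξ : Fin n → MvPowerSeries (Fin n) F} (hξ : ξ ∈ weightFiltration F a a s)
    {f : Fin m → MvPowerSeries (Fin n) F} (hf : f ∈ weightFiltration F a d r) :
    Λ.mulVec f + (jacobian f).mulVec ξ ∈ weightFiltration F a d (r + s) := by
  refine add_mem (mulVec_mem_weightFiltration hΛ hf) (mem_weightFiltration.2 fun i => ?_)
  rw [jacobian_mulVec]
  exact ordIdeal_anti (by omega) (vectorField_mem (mem_weightFiltration_self.1 hξ) (hf i))

/-- The tangent image of a weighted homogeneous isolated complete intersection singularity contains
all vectors of large order, in a way compatible with the filtrations. -/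
theorem exists_weightFiltration_le_tangentImage [Infinite F] {r : ℕ}
    {f : Fin m → MvPowerSeries (Fin n) F} (hf : IsICIS f) (hfw : IsWeightedHomog a d r f) :
    ∃ e₀ : ℕ, 1 ≤ e₀ ∧ ∀ e, e₀ ≤ e →
      weightFiltration F a d (r + e) ≤ tangentImage a d e f := by
  classical
  obtain ⟨-, k, hk⟩ := hf
  have hwt : ∀ i γ, coeff γ (f i) ≠ 0 → Finsupp.weight a γ + 0 = r + d i :=
    fun i γ hγ => hfw.weight_eq hγ
  have hfr : f ∈ weightFiltration F a d r := by
    refine mem_weightFiltration.2 fun i => mem_ordIdeal_iff_coeff.2 fun α hα => ?_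
    by_contra h
    exact absurd (hwt i α h) (by omega)
  -- This order puts each component of `h` into `𝔪^k`, hence into `I + I_m(J(f))`; the final 1
  -- ensures `1 ≤ e₀`.
  refine ⟨k * (∑ j, a j + 1) + 1, by omega, fun e he h hh => ?_⟩
  have hmem : h ∈ fullTangent f := by
    rw [← Finset.univ_sum_single h]
    refine Submodule.sum_mem _ fun i _ => ?_
    have : (Pi.single i (h i) : Fin m → MvPowerSeries (Fin n) F) = h i • Pi.single i 1 := by
      rw [← Pi.single_smul, smul_eq_mul, mul_one]
    rw [this]
    exact smul_mem_fullTangent (hk (ordIdeal_le_varIdeal_pow k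
      (ordIdeal_anti (by omega) (mem_weightFiltration.1 hh i)))) _
  obtain ⟨Λ, ξ, hΛξ⟩ := hmem
  -- Since `f` is homogeneous, the low weight parts of `Λ` and `ξ` contribute only in weights where
  -- `h` vanishes, so they can be cut off.
  set Λ' : Matrix (Fin m) (Fin m) (MvPowerSeries (Fin n) F) :=
    Matrix.of fun j i => highPart a (e + d j - d i) (Λ j i) with hΛ'
  set ξ' : Fin n → MvPowerSeries (Fin n) F := fun j => highPart a (a j + e) (ξ j) with hξ'
  have h1 : Λ' ∈ matrixFiltration F a d e := mem_matrixFiltration.2 fun j i => highPart_mem _ _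
  have h2 : ξ' ∈ weightFiltration F a a e := mem_weightFiltration_self.2 fun j => highPart_mem _ _
  refine ⟨Λ', h1, ξ', h2, ?_⟩
  have h3 := mulVec_add_jacobian_mulVec_mem h1 h2 hfr
  ext i β
  by_cases hβ : Finsupp.weight a β < r + e + d i
  · rw [mem_ordIdeal_iff_coeff.1 (hh i) β hβ, mem_ordIdeal_iff_coeff.1 (h3 i) β hβ]
  · rw [hΛξ, Pi.add_apply, Pi.add_apply, map_add, map_add]
    simp only [Matrix.mulVec, dotProduct, map_sum]
    congr 1
    · refine Finset.sum_congr rfl fun l _ => ?_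
      rw [hΛ', Matrix.of_apply, coeff_highPart_mul (hwt l)]
      omega
    · refine Finset.sum_congr rfl fun l _ => ?_
      rw [mul_comm, mul_comm _ (ξ' l), coeff_highPart_mul (b := a l) (w := r + d i)]
      · intro γ hγ
        rw [jacobian, Matrix.of_apply, coeff_pderiv] at hγ
        have := hwt i _ (left_ne_zero_of_mul hγ)
        rw [map_add, Finsupp.weight_single, smul_eq_mul, one_mul] at this
        exact this
      · omega

end Tangent

/-! ### Finite determinacy by successive approximation. -/

section Determinacy

variable {F : Type*} [Field F] {n m : ℕ} {a : Fin n → ℕ} {d : Fin m → ℕ}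

/-- The first order variation of `(1 + Λ) k(x + ξ)` in `(Λ, ξ)`, for `k` with initial part `f`. -/
theorem one_add_mulVec_subst_variation (ha : ∀ j, 0 < a j) {r s : ℕ} (hs : 1 ≤ s)
    {f k : Fin m → MvPowerSeries (Fin n) F} (hf : f ∈ weightFiltration F a d r)
    (hk : k - f ∈ weightFiltration F a d (r + 1))
    {Λ Δ : Matrix (Fin m) (Fin m) (MvPowerSeries (Fin n) F)}
    (hΛ : Λ ∈ matrixFiltration F a d 1) (hΔ : Δ ∈ matrixFiltration F a d s)
    {ξ δ : Fin n → MvPowerSeries (Fin n) F}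
    (hξ : ξ ∈ weightFiltration F a a 1) (hδ : δ ∈ weightFiltration F a a s) :
    (1 + (Λ + Δ)).mulVec (fun i => subst (fun j => X j + (ξ + δ) j) (k i)) -
      (1 + Λ).mulVec (fun i => subst (fun j => X j + ξ j) (k i)) -
      (Δ.mulVec f + (jacobian f).mulVec δ) ∈ weightFiltration F a d (r + s + 1) := by
  set K₁ : Fin m → MvPowerSeries (Fin n) F :=
    fun i => subst (fun j => X j + (ξ + δ) j) (k i) with hK₁
  set K₀ : Fin m → MvPowerSeries (Fin n) F := fun i => subst (fun j => X j + ξ j) (k i) with hK₀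
  have hkr : k ∈ weightFiltration F a d r := by
    simpa using add_mem (weightFiltration_anti (Nat.le_succ r) hk) hf
  have hξ' := mem_weightFiltration_self.1 hξ
  have hδ' := mem_weightFiltration_self.1 hδ
  have h1 : K₁ - K₀ - (fun i => vectorField δ (k i)) ∈ weightFiltration F a d (r + s + 1) :=
    mem_weightFiltration.2 fun i => ordIdeal_anti (by omega)
      (subst_add_sub_subst_sub_vectorField_mem ha hs hξ' hδ' (mem_weightFiltration.1 hkr i))
  have h2 : (fun i => vectorField δ (k i)) - (jacobian f).mulVec δ ∈
      weightFiltration F a d (r + s + 1) := mem_weightFiltration.2 fun i => by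
    rw [Pi.sub_apply, jacobian_mulVec, ← map_sub]
    exact ordIdeal_anti (by omega) (vectorField_mem hδ' (mem_weightFiltration.1 hk i))
  have h3 : K₁ - K₀ ∈ weightFiltration F a d (r + s) := mem_weightFiltration.2 fun i => by
    have := add_mem (ordIdeal_anti (show r + s + d i ≤ r + s + 1 + d i by omega)
      (mem_weightFiltration.1 h1 i))
      (ordIdeal_anti (show r + s + d i ≤ r + d i + s by omega)
        (vectorField_mem hδ' (mem_weightFiltration.1 hkr i)))
    simpa using this
  have h4 : K₀ - f ∈ weightFiltration F a d (r + 1) := by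
    have : K₀ - k ∈ weightFiltration F a d (r + 1) := mem_weightFiltration.2 fun i =>
      ordIdeal_anti (by omega) (subst_X_add_sub_mem ha hξ' (mem_weightFiltration.1 hkr i))
    simpa using add_mem this hk
  have h5 : K₁ - f ∈ weightFiltration F a d (r + 1) := by
    have := add_mem (weightFiltration_anti (by omega : r + 1 ≤ r + s) h3) h4
    simpa using this
  have h6 := mulVec_mem_weightFiltration hΛ h3
  have h7 := weightFiltration_anti (by omega : r + s + 1 ≤ r + 1 + s)
    (mulVec_mem_weightFiltration hΔ h5)
  -- The error splits into the Taylor remainder, the replacement of `k` by `f` under the vector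
  -- field, `Λ (K₁ - K₀)` and `Δ (K₁ - f)`.
  convert add_mem (add_mem (add_mem h1 h2) h6) h7 using 1
  simp only [Matrix.add_mulVec, Matrix.one_mulVec, Matrix.mulVec_sub]
  abel

/-- Higher order terms can be removed within the contact class once they are tangent. -/
theorem contactEquiv_add_of_le_tangentImage (ha : ∀ j, 0 < a j) {r e₀ : ℕ} (he₀ : 1 ≤ e₀)
    {f : Fin m → MvPowerSeries (Fin n) F} (hf : f ∈ weightFiltration F a d r)
    (hT : ∀ e, e₀ ≤ e → weightFiltration F a d (r + e) ≤ tangentImage a d e f)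
    {k h : Fin m → MvPowerSeries (Fin n) F} (hk : k - f ∈ weightFiltration F a d (r + 1))
    (hh : h ∈ weightFiltration F a d (r + e₀)) : ContactEquiv k (k + h) := by
  -- The membership condition sits inside the existential so that `choose` yields total functions;
  -- outside the filtration the value is 0.
  have hsol : ∀ (s : ℕ) (v : Fin m → MvPowerSeries (Fin n) F), ∃ (Δ : Matrix (Fin m) (Fin m)
      (MvPowerSeries (Fin n) F)) (δ : Fin n → MvPowerSeries (Fin n) F),
      v ∈ weightFiltration F a d (r + (e₀ + s)) → Δ ∈ matrixFiltration F a d (e₀ + s) ∧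
        δ ∈ weightFiltration F a a (e₀ + s) ∧ v = Δ.mulVec f + (jacobian f).mulVec δ := by
    intro s v
    by_cases hv : v ∈ weightFiltration F a d (r + (e₀ + s))
    · obtain ⟨Δ, hΔ, δ, hδ, h⟩ := hT (e₀ + s) (by omega) hv
      exact ⟨Δ, δ, fun _ => ⟨hΔ, hδ, h⟩⟩
    · exact ⟨0, 0, fun h => absurd h hv⟩
  choose D δ hDδ using hsol
  -- Corrections are added to `(Λ, ξ)` with `k` fixed, rather than composed as group elements, so
  -- the limit is taken coefficientwise in `Λ` and `ξ`. Each step gains one order.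
  let act : Matrix (Fin m) (Fin m) (MvPowerSeries (Fin n) F) →
      (Fin n → MvPowerSeries (Fin n) F) → Fin m → MvPowerSeries (Fin n) F :=
    fun Λ ξ => (1 + Λ).mulVec (fun i => subst (fun j => X j + ξ j) (k i))
  let L : ℕ → Matrix (Fin m) (Fin m) (MvPowerSeries (Fin n) F) ×
      (Fin n → MvPowerSeries (Fin n) F) := fun s => Nat.rec (0, 0)
    (fun s p => (p.1 + D s (k + h - act p.1 p.2), p.2 + δ s (k + h - act p.1 p.2))) s
  have hL1 : ∀ s, (L (s + 1)).1 = (L s).1 + D s (k + h - act (L s).1 (L s).2) := fun _ => rfl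
  have hL2 : ∀ s, (L (s + 1)).2 = (L s).2 + δ s (k + h - act (L s).1 (L s).2) := fun _ => rfl
  have hinv : ∀ s, (L s).1 ∈ matrixFiltration F a d 1 ∧ (L s).2 ∈ weightFiltration F a a 1 ∧
      k + h - act (L s).1 (L s).2 ∈ weightFiltration F a d (r + (e₀ + s)) := by
    intro s
    induction s with
    | zero =>
      refine ⟨zero_mem _, zero_mem _, ?_⟩
      have : act (L 0).1 (L 0).2 = k := by
        change (1 + (0 : Matrix (Fin m) (Fin m) (MvPowerSeries (Fin n) F))).mulVec
          (fun i => subst (fun j => X j + (0 : MvPowerSeries (Fin n) F)) (k i)) = k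
        simp only [add_zero, Matrix.one_mulVec]
        ext1 i
        exact congrFun subst_self (k i)
      rw [this]
      simpa using hh
    | succ s ih =>
      obtain ⟨h1, h2, h3⟩ := ih
      obtain ⟨h4, h5, h6⟩ := hDδ s _ h3
      have hvar := one_add_mulVec_subst_variation ha (by omega) hf hk h1 h4 h2 h5
      refine ⟨?_, ?_, ?_⟩
      · rw [hL1]; exact add_mem h1 (matrixFiltration_anti (by omega) h4)
      · rw [hL2]; exact add_mem h2 (weightFiltration_anti (by omega) h5)
      · rw [← h6] at hvar
        have := neg_mem hvar
        rw [hL1, hL2, show r + (e₀ + (s + 1)) = r + (e₀ + s) + 1 by omega]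
        convert this using 1
        change k + h - act _ _ = -(act _ _ - act _ _ - _)
        abel
  have hstep := fun s => hDδ s _ (hinv s).2.2
  have hΛlim : ∀ j i, ∃ v, ∀ s, v - (L s).1 j i ∈ ordIdeal F a (e₀ + s + d j - d i) := by
    intro j i
    refine exists_limit (fun s => (L s).1 j i) (fun s => e₀ + s + d j - d i) (fun s t hst => ?_)
      (fun p => ⟨p + 1 + d i, ?_⟩) (fun s => ?_)
    · beta_reduce; omega
    · omega
    · change (L (s + 1)).1 j i - (L s).1 j i ∈ _
      rw [hL1, Matrix.add_apply, add_sub_cancel_left]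
      exact mem_matrixFiltration.1 (hstep s).1 j i
  have hξlim : ∀ j, ∃ v, ∀ s, v - (L s).2 j ∈ ordIdeal F a (a j + (e₀ + s)) := by
    intro j
    refine exists_limit (fun s => (L s).2 j) (fun s => a j + (e₀ + s)) (fun s t hst => ?_)
      (fun p => ⟨p + 1, ?_⟩) (fun s => ?_)
    · beta_reduce; omega
    · omega
    · change (L (s + 1)).2 j - (L s).2 j ∈ _
      rw [hL2, Pi.add_apply, add_sub_cancel_left]
      exact mem_weightFiltration_self.1 (hstep s).2.1 j
  choose Λ hΛ using hΛlim
  choose ξ hξ using hξlim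
  have hΛs : ∀ s, (Matrix.of Λ) - (L s).1 ∈ matrixFiltration F a d (e₀ + s) := fun s =>
    mem_matrixFiltration.2 fun j i => hΛ j i s
  have hξs : ∀ s, ξ - (L s).2 ∈ weightFiltration F a a (e₀ + s) := fun s =>
    mem_weightFiltration_self.2 fun j => hξ j s
  have hΛ1 : Matrix.of Λ ∈ matrixFiltration F a d 1 := by
    simpa using add_mem (matrixFiltration_anti (by omega) (hΛs 0)) (hinv 0).1
  have hξ1 : ξ ∈ weightFiltration F a a 1 := by
    simpa using add_mem (weightFiltration_anti (by omega) (hξs 0)) (hinv 0).2.1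
  have hlim : k + h = act (Matrix.of Λ) ξ := by
    have hmem : ∀ s, k + h - act (Matrix.of Λ) ξ ∈ weightFiltration F a d (r + (e₀ + s)) := by
      intro s
      -- The same variation estimate compares the limit with stage `s`.
      have hvar := one_add_mulVec_subst_variation ha (by omega) hf hk (hinv s).1 (hΛs s)
        (hinv s).2.1 (hξs s)
      rw [add_sub_cancel, add_sub_cancel] at hvar
      have h1 := add_mem (weightFiltration_anti (Nat.le_succ _) hvar)
        (mulVec_add_jacobian_mulVec_mem (hΛs s) (hξs s) hf)
      rw [sub_add_cancel] at h1
      have := sub_mem (hinv s).2.2 h1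
      convert this using 1
      change k + h - act _ _ = k + h - act _ _ - (act _ _ - act _ _)
      abel
    rw [← sub_eq_zero]
    ext1 i
    refine eq_zero_of_forall_mem_ordIdeal (a := a) fun p => ?_
    exact ordIdeal_anti (by omega) (mem_weightFiltration.1 (hmem p) i)
  rw [hlim]
  exact contactEquiv_one_add_mulVec_subst ha hΛ1 hξ1 k

end Determinacy

/-! ### Formal implicit functions and the Nullstellensatz. -/

section FormalSolution

variable {F : Type*} [Field F] {ι : Type*}

/-- The point with coordinates `u` and parameter `X`. -/
noncomputable def paramPoint (u : ι → PowerSeries F) : Option ι → PowerSeries F :=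
  fun o => o.elim PowerSeries.X u

theorem X_dvd_aeval_paramPoint {u : ι → PowerSeries F} (hu : ∀ i, PowerSeries.X ∣ u i)
    {q : MvPolynomial (Option ι) F} (hq : q ∈ MvPolynomial.idealOfVars (Option ι) F) :
    PowerSeries.X ∣ MvPolynomial.aeval (paramPoint u) q := by
  have : MvPolynomial.idealOfVars (Option ι) F ≤
      (Ideal.span {PowerSeries.X}).comap (MvPolynomial.aeval (paramPoint u)) := by
    refine Ideal.span_le.2 ?_
    rintro _ ⟨o, rfl⟩
    simp only [SetLike.mem_coe, Ideal.mem_comap, MvPolynomial.aeval_X, Ideal.mem_span_singleton]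
    cases o with
    | none => exact dvd_rfl
    | some i => exact hu i
  exact Ideal.mem_span_singleton.1 (this hq)

theorem X_pow_dvd_aeval_sub {u v : ι → PowerSeries F} {k : ℕ}
    (huv : ∀ i, PowerSeries.X ^ k ∣ u i - v i) (q : MvPolynomial (Option ι) F) :
    PowerSeries.X ^ k ∣
      MvPolynomial.aeval (paramPoint u) q - MvPolynomial.aeval (paramPoint v) q := by
  induction q using MvPolynomial.induction_on with
  | C c => simp
  | add p q hp hq =>
    rw [map_add, map_add, add_sub_add_comm]
    exact dvd_add hp hq
  | mul_X p o hp =>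
    have ho : PowerSeries.X ^ k ∣ paramPoint u o - paramPoint v o := by
      cases o with
      | none => simp [paramPoint]
      | some i => exact huv i
    rw [map_mul, map_mul, MvPolynomial.aeval_X, MvPolynomial.aeval_X]
    have : ∀ x y z w : PowerSeries F, x * z - y * w = (x - y) * z + y * (z - w) := by
      intros; ring
    rw [this]
    exact dvd_add (hp.mul_right _) (ho.mul_left _)

/-- Without constant and linear terms, each difference is multiplied by a factor divisible by `X`,
so evaluation is contracting. -/
theorem X_pow_succ_dvd_aeval_sub {u v : ι → PowerSeries F} {k : ℕ}
    (hu : ∀ i, PowerSeries.X ∣ u i) (hv : ∀ i, PowerSeries.X ∣ v i)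
    (huv : ∀ i, PowerSeries.X ^ k ∣ u i - v i) {q : MvPolynomial (Option ι) F}
    (hq : q ∈ MvPolynomial.idealOfVars (Option ι) F ^ 2) :
    PowerSeries.X ^ (k + 1) ∣
      MvPolynomial.aeval (paramPoint u) q - MvPolynomial.aeval (paramPoint v) q := by
  rw [pow_two] at hq
  induction hq using Submodule.mul_induction_on' with
  | mem_mul_mem p hp q hq =>
    rw [map_mul, map_mul]
    have : ∀ x y z w : PowerSeries F, x * z - y * w = (x - y) * z + (z - w) * y := by
      intros; ring
    rw [this, pow_succ]
    exact dvd_add (mul_dvd_mul (X_pow_dvd_aeval_sub huv p) (X_dvd_aeval_paramPoint hu hq))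
      (mul_dvd_mul (X_pow_dvd_aeval_sub huv q) (X_dvd_aeval_paramPoint hv hp))
  | add p _ q _ hp hq =>
    rw [map_add, map_add, add_sub_add_comm]
    exact dvd_add hp hq

variable [DecidableEq ι]

theorem sub_linear_mem_idealOfVars_sq {P : MvPolynomial (Option ι) F} {i : ι}
    (h0 : P.coeff 0 = 0)
    (h1 : ∀ j, P.coeff (Finsupp.single (some j) 1) = if i = j then 1 else 0) :
    P - MvPolynomial.X (some i) - MvPolynomial.C (P.coeff (Finsupp.single none 1)) *
      MvPolynomial.X none ∈ MvPolynomial.idealOfVars (Option ι) F ^ 2 := by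
  rw [MvPolynomial.mem_pow_idealOfVars_iff']
  intro x hx
  have hx' : x = 0 ∨ ∃ o, x = Finsupp.single o 1 := by
    rcases Nat.lt_or_ge (Finsupp.degree x) 1 with h | h
    · left
      exact (Finsupp.degree_eq_zero_iff x).1 (by omega)
    · right
      have h1 : Finsupp.degree x = 1 := by omega
      rw [Finsupp.degree_apply] at h1
      obtain ⟨o, ho⟩ := (Finsupp.sum_eq_one_iff x).1 h1
      exact ⟨o, ho⟩
  rcases hx' with rfl | ⟨o, rfl⟩
  · simp [h0]
  · cases o with
    | none => simp [MvPolynomial.coeff_X, Finsupp.single_left_inj]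
    | some j =>
      have : ∀ c : F, MvPolynomial.coeff (Finsupp.single (some j) 1)
          (MvPolynomial.C c * MvPolynomial.X none : MvPolynomial (Option ι) F) = 0 := by
        intro c
        rw [MvPolynomial.coeff_C_mul, MvPolynomial.coeff_X, if_neg, mul_zero]
        rw [Finsupp.single_left_inj one_ne_zero]
        exact Option.some_ne_none j |>.symm
      simp [MvPolynomial.coeff_X, h1, this, Finsupp.single_left_inj]

/-- The formal implicit function theorem for polynomial equations with a parameter. -/
theorem exists_formal_solution {P : ι → MvPolynomial (Option ι) F}
    (h0 : ∀ i, (P i).coeff 0 = 0)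
    (h1 : ∀ i j, (P i).coeff (Finsupp.single (some j) 1) = if i = j then 1 else 0) :
    ∃ u : ι → PowerSeries F, ∀ i, MvPolynomial.aeval (paramPoint u) (P i) = 0 := by
  -- In `P i - xᵢ` the linear parameter term cancels between `u` and `v` and the rest is quadratic.
  -- So `u ↦ u - P(u)` is an `X`-adic contraction whose fixed points are the solutions.
  have hcontr : ∀ (k : ℕ) (u v : ι → PowerSeries F), (∀ i, PowerSeries.X ∣ u i) →
      (∀ i, PowerSeries.X ∣ v i) → (∀ i, PowerSeries.X ^ k ∣ u i - v i) → ∀ i,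
      PowerSeries.X ^ (k + 1) ∣ (MvPolynomial.aeval (paramPoint u) (P i) - u i) -
        (MvPolynomial.aeval (paramPoint v) (P i) - v i) := by
    intro k u v hu hv huv i
    have := X_pow_succ_dvd_aeval_sub hu hv huv (sub_linear_mem_idealOfVars_sq (h0 i) (h1 i))
    simp only [map_sub, map_mul, MvPolynomial.aeval_X, MvPolynomial.aeval_C, paramPoint,
      Option.elim] at this
    convert this using 1
    ring
  have hP : ∀ i, P i ∈ MvPolynomial.idealOfVars (Option ι) F := by
    intro i
    rw [← pow_one (MvPolynomial.idealOfVars (Option ι) F), MvPolynomial.mem_pow_idealOfVars_iff']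
    intro x hx
    rw [(Finsupp.degree_eq_zero_iff x).1 (by omega), h0]
  let u : ℕ → ι → PowerSeries F := fun k =>
    Nat.rec 0 (fun _ v i => v i - MvPolynomial.aeval (paramPoint v) (P i)) k
  have hu : ∀ k i, u (k + 1) i = u k i - MvPolynomial.aeval (paramPoint (u k)) (P i) :=
    fun _ _ => rfl
  have hX : ∀ k i, PowerSeries.X ∣ u k i := by
    intro k
    induction k with
    | zero => exact fun i => dvd_zero _
    | succ k ih => exact fun i => dvd_sub (ih i) (X_dvd_aeval_paramPoint ih (hP i))
  have hres : ∀ k i, PowerSeries.X ^ (k + 1) ∣ MvPolynomial.aeval (paramPoint (u k)) (P i) := by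
    intro k
    induction k with
    | zero => exact fun i => by simpa using X_dvd_aeval_paramPoint (hX 0) (hP i)
    | succ k ih =>
      intro i
      have := hcontr (k + 1) (u (k + 1)) (u k) (hX (k + 1)) (hX k)
        (fun i => by rw [hu, sub_sub_cancel_left]; exact (ih i).neg_right) i
      convert this using 1
      rw [hu k i]
      ring
  have hdiff : ∀ i k l, k ≤ l → PowerSeries.X ^ (k + 1) ∣ u l i - u k i := by
    intro i k l hkl
    induction l, hkl using Nat.le_induction with
    | base => simp
    | succ l hkl ih =>
      have h2 : PowerSeries.X ^ (k + 1) ∣ MvPolynomial.aeval (paramPoint (u l)) (P i) :=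
        (pow_dvd_pow _ (by omega)).trans (hres l i)
      rw [hu, sub_right_comm]
      exact dvd_sub ih h2
  let v : ι → PowerSeries F := fun i => PowerSeries.mk fun p => PowerSeries.coeff p (u p i)
  have hv : ∀ k i, PowerSeries.X ^ (k + 1) ∣ v i - u k i := by
    intro k i
    rw [PowerSeries.X_pow_dvd_iff]
    intro p hp
    have := PowerSeries.X_pow_dvd_iff.1 (hdiff i p k (by omega)) p (by omega)
    rw [map_sub, sub_eq_zero] at this
    rw [map_sub, PowerSeries.coeff_mk, this, sub_self]
  refine ⟨v, fun i => ?_⟩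
  ext p
  have h2 : PowerSeries.X ^ (p + 1) ∣ MvPolynomial.aeval (paramPoint v) (P i) := by
    have := dvd_add (X_pow_dvd_aeval_sub (hv p) (P i)) (hres p i)
    rwa [sub_add_cancel] at this
  rw [PowerSeries.X_pow_dvd_iff.1 h2 p (by omega), map_zero]

/-- A system of polynomial equations that defines a smooth curve germ transversal to the hyperplane
where the parameter vanishes has a solution whose parameter is not zero. -/
theorem exists_solution_param_ne_zero [IsAlgClosed F] [Finite ι]
    {P : ι → MvPolynomial (Option ι) F} (h0 : ∀ i, (P i).coeff 0 = 0)
    (h1 : ∀ i j, (P i).coeff (Finsupp.single (some j) 1) = if i = j then 1 else 0) :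
    ∃ x : Option ι → F, x none ≠ 0 ∧ ∀ i, MvPolynomial.aeval x (P i) = 0 := by
  obtain ⟨u, hu⟩ := exists_formal_solution h0 h1
  by_contra! hcon
  set I : Ideal (MvPolynomial (Option ι) F) := Ideal.span (Set.range P) with hI
  -- If the parameter vanished at every `F`-solution, a power of it would lie in the ideal; at the
  -- formal solution that power is `X ^ N`, which is not 0.
  have hmem : (MvPolynomial.X none : MvPolynomial (Option ι) F) ∈ I.radical := by
    rw [← MvPolynomial.vanishingIdeal_zeroLocus_eq_radical (K := F),
      MvPolynomial.mem_vanishingIdeal_iff]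
    intro x hx
    rw [MvPolynomial.aeval_X]
    by_contra hne
    obtain ⟨i, hi⟩ := hcon x hne
    exact hi (hx (P i) (Ideal.subset_span ⟨i, rfl⟩))
  obtain ⟨N, hN⟩ := hmem
  have hle : I ≤ RingHom.ker (MvPolynomial.aeval (paramPoint u) : _ →ₐ[F] PowerSeries F) := by
    refine Ideal.span_le.2 ?_
    rintro _ ⟨i, rfl⟩
    exact hu i
  have := hle hN
  rw [RingHom.mem_ker, map_pow, MvPolynomial.aeval_X] at this
  exact PowerSeries.X_ne_zero (eq_zero_of_pow_eq_zero this)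

end FormalSolution

/-! ### Linear terms via dual numbers. -/

section DualNumber

/-- Evaluation at the point `ε eₒ` of the dual numbers reads off the constant and linear terms. -/
theorem aeval_single_eps {F σ : Type*} [Field F] [DecidableEq σ] (o : σ) (P : MvPolynomial σ F) :
    MvPolynomial.aeval (Pi.single o DualNumber.eps : σ → DualNumber F) P =
      TrivSqZeroExt.inl (P.coeff 0) + TrivSqZeroExt.inr (P.coeff (Finsupp.single o 1)) := by
  classical
  induction P using MvPolynomial.induction_on with
  | C c =>
    rw [MvPolynomial.aeval_C, MvPolynomial.coeff_C, MvPolynomial.coeff_C, if_pos rfl, if_neg]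
    · simp [TrivSqZeroExt.algebraMap_eq_inl]
    · exact fun h => by simpa using (DFunLike.congr_fun h o).symm
  | add p q hp hq =>
    rw [map_add, hp, hq, MvPolynomial.coeff_add, MvPolynomial.coeff_add, TrivSqZeroExt.inl_add,
      TrivSqZeroExt.inr_add]
    abel
  | mul_X p l hp =>
    rw [map_mul, hp, MvPolynomial.aeval_X, MvPolynomial.coeff_mul_X', MvPolynomial.coeff_mul_X']
    by_cases hl : l = o
    · subst hl
      ext <;> simp
    · rw [Pi.single_eq_of_ne hl, if_neg (by simp), if_neg (by simpa using hl)]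
      simp

end DualNumber

/-! ### The degeneration of `g` to `f` and the group action on it. -/

section Family

variable {F : Type*} [Field F] {n m : ℕ} {a : Fin n → ℕ} {d : Fin m → ℕ}

/-- The series `c ^ (-w) h(c^{a₁} x₁, …, c^{aₙ} xₙ)`, for `h` of weighted order at least `w`. -/
noncomputable def scaledSeries {A : Type*} [CommRing A] [Algebra F A] (a : Fin n → ℕ) (w : ℕ)
    (c : A) (h : MvPowerSeries (Fin n) F) : MvPowerSeries (Fin n) A :=
  -- The truncated exponent makes the dependence on `c` polynomial, so `c = 0` is allowed;
  -- coefficients of weight at most `w` stay fixed.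
  fun α => c ^ (Finsupp.weight a α - w) * algebraMap F A (coeff α h)

theorem coeff_scaledSeries {A : Type*} [CommRing A] [Algebra F A] (w : ℕ) (c : A)
    (h : MvPowerSeries (Fin n) F) (α : Fin n →₀ ℕ) :
    coeff α (scaledSeries a w c h) =
      c ^ (Finsupp.weight a α - w) * algebraMap F A (coeff α h) :=
  coeff_apply (scaledSeries a w c h) α

theorem map_scaledSeries {A B : Type*} [CommRing A] [Algebra F A] [CommRing B] [Algebra F B]
    (θ : A →ₐ[F] B) (w : ℕ) (c : A) (h : MvPowerSeries (Fin n) F) :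
    MvPowerSeries.map (θ : A →+* B) (scaledSeries a w c h) = scaledSeries a w (θ c) h := by
  ext α
  simp [coeff_scaledSeries]

variable {ι : Type*} [Fintype ι]

/-- The matrix `∑ₗ xₗ Λₗ`. -/
noncomputable def familyMatrix {A : Type*} [CommRing A] [Algebra F A]
    (L : ι → Matrix (Fin m) (Fin m) (MvPowerSeries (Fin n) F)) (x : Option ι → A) :
    Matrix (Fin m) (Fin m) (MvPowerSeries (Fin n) A) :=
  Matrix.of fun j i => ∑ l, x (some l) • MvPowerSeries.map (algebraMap F A) (L l j i)

/-- The vector field `∑ₗ xₗ ξₗ`. -/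
noncomputable def familyField {A : Type*} [CommRing A] [Algebra F A]
    (Z : ι → Fin n → MvPowerSeries (Fin n) F) (x : Option ι → A) :
    Fin n → MvPowerSeries (Fin n) A :=
  fun j => ∑ l, x (some l) • MvPowerSeries.map (algebraMap F A) (Z l j)

/-- The family obtained by acting with `(1 + ∑ xₗ Λₗ, x ↦ x + ∑ xₗ ξₗ)` on the rescaled `g`. -/
noncomputable def familySeries {A : Type*} [CommRing A] [Algebra F A] (a : Fin n → ℕ)
    (d : Fin m → ℕ) (r : ℕ) (L : ι → Matrix (Fin m) (Fin m) (MvPowerSeries (Fin n) F))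
    (Z : ι → Fin n → MvPowerSeries (Fin n) F) (g : Fin m → MvPowerSeries (Fin n) F)
    (x : Option ι → A) : Fin m → MvPowerSeries (Fin n) A :=
  (1 + familyMatrix L x).mulVec fun i =>
    subst (fun j => X j + familyField Z x j) (scaledSeries a (r + d i) (x none) (g i))

theorem map_algebraMap_comp {A B : Type*} [CommRing A] [Algebra F A] [CommRing B] [Algebra F B]
    (θ : A →ₐ[F] B) (h : MvPowerSeries (Fin n) F) :
    MvPowerSeries.map (θ : A →+* B) (MvPowerSeries.map (algebraMap F A) h) =
      MvPowerSeries.map (algebraMap F B) h := by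
  ext α
  simp

theorem map_smul_algHom {A B : Type*} [CommRing A] [Algebra F A] [CommRing B] [Algebra F B]
    (θ : A →ₐ[F] B) (c : A) (h : MvPowerSeries (Fin n) A) :
    MvPowerSeries.map (θ : A →+* B) (c • h) = θ c • MvPowerSeries.map (θ : A →+* B) h := by
  ext α
  simp

theorem familyField_mem {A : Type*} [CommRing A] [Algebra F A] {s : ℕ}
    {Z : ι → Fin n → MvPowerSeries (Fin n) F} (hZ : ∀ l j, Z l j ∈ ordIdeal F a (a j + s))
    (x : Option ι → A) (j : Fin n) : familyField Z x j ∈ ordIdeal A a (a j + s) :=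
  Ideal.sum_mem _ fun l _ => smul_mem_ordIdeal _ (map_mem_ordIdeal _ (hZ l j))

/-- Base change lets one family over the polynomial ring be evaluated both over the dual numbers,
for its linear terms, and over `F`. -/
theorem map_familySeries {A B : Type*} [CommRing A] [Algebra F A] [CommRing B] [Algebra F B]
    (ha : ∀ j, 0 < a j) (θ : A →ₐ[F] B) (r : ℕ)
    (L : ι → Matrix (Fin m) (Fin m) (MvPowerSeries (Fin n) F))
    {Z : ι → Fin n → MvPowerSeries (Fin n) F} (hZ : ∀ l j, Z l j ∈ ordIdeal F a (a j + 1))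
    (g : Fin m → MvPowerSeries (Fin n) F) (x : Option ι → A) (k : Fin m) :
    MvPowerSeries.map (θ : A →+* B) (familySeries a d r L Z g x k) =
      familySeries a d r L Z g (fun o => θ (x o)) k := by
  have hs := hasSubst_of_mem_ordIdeal ha
    (X_add_mem fun j => ordIdeal_anti (Nat.le_succ _) (familyField_mem hZ x j))
  have hM : ∀ j i, MvPowerSeries.map (θ : A →+* B) ((1 + familyMatrix L x) j i) =
      (1 + familyMatrix L fun o => θ (x o)) j i := by
    intro j i
    rw [Matrix.add_apply, Matrix.add_apply, map_add]
    congr 1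
    · rw [Matrix.one_apply, Matrix.one_apply]
      split_ifs <;> simp
    · rw [familyMatrix, familyMatrix, Matrix.of_apply, Matrix.of_apply, map_sum]
      exact Finset.sum_congr rfl fun l _ => by rw [map_smul_algHom, map_algebraMap_comp]
  have hZ' : ∀ j, MvPowerSeries.map (θ : A →+* B) (X j + familyField Z x j) =
      X j + familyField Z (fun o => θ (x o)) j := by
    intro j
    rw [map_add, MvPowerSeries.map_X, familyField, familyField, map_sum]
    congr 1
    exact Finset.sum_congr rfl fun l _ => by rw [map_smul_algHom, map_algebraMap_comp]
  rw [familySeries, familySeries, Matrix.mulVec, Matrix.mulVec, dotProduct, dotProduct, map_sum]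
  refine Finset.sum_congr rfl fun i _ => ?_
  rw [map_mul, hM, map_subst hs, map_scaledSeries]
  simp only [hZ']

theorem map_vectorField {A : Type*} [CommRing A] [Algebra F A]
    (ξ : Fin n → MvPowerSeries (Fin n) F) (h : MvPowerSeries (Fin n) F) :
    vectorField (fun j => MvPowerSeries.map (algebraMap F A) (ξ j))
      (MvPowerSeries.map (algebraMap F A) h) =
      MvPowerSeries.map (algebraMap F A) (vectorField ξ h) := by
  rw [vectorField_apply, vectorField_apply, map_sum]
  refine Finset.sum_congr rfl fun j _ => ?_
  rw [map_mul]
  congr 1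
  ext α
  simp [coeff_pderiv]

/-- The initial part of `g` is recovered at the parameter value zero. -/
theorem scaledSeries_zero {A : Type*} [CommRing A] [Algebra F A] {w : ℕ}
    {f g : MvPowerSeries (Fin n) F} (hf : ∀ α, coeff α f ≠ 0 → Finsupp.weight a α = w)
    (hg : g - f ∈ ordIdeal F a (w + 1)) :
    scaledSeries a w (0 : A) g = MvPowerSeries.map (algebraMap F A) f := by
  ext α
  rw [coeff_scaledSeries, coeff_map]
  rcases lt_or_ge w (Finsupp.weight a α) with h | h
  · have : coeff α f = 0 := by
      by_contra hne
      exact absurd (hf α hne) (by omega)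
    rw [this, map_zero, zero_pow (by omega), zero_mul]
  · have := mem_ordIdeal_iff_coeff.1 hg α (by omega)
    rw [map_sub, sub_eq_zero] at this
    rw [this, Nat.sub_eq_zero_of_le h, pow_zero, one_mul]

/-- The first order variation of the family at the origin. -/
theorem familySeries_single_eps [DecidableEq ι] (ha : ∀ j, 0 < a j) {r : ℕ}
    (L : ι → Matrix (Fin m) (Fin m) (MvPowerSeries (Fin n) F))
    {Z : ι → Fin n → MvPowerSeries (Fin n) F} (hZ : ∀ l j, Z l j ∈ ordIdeal F a (a j + 1))
    {f g : Fin m → MvPowerSeries (Fin n) F}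
    (hf : ∀ i α, coeff α (f i) ≠ 0 → Finsupp.weight a α = r + d i)
    (hg : g - f ∈ weightFiltration F a d (r + 1)) (l : ι) (k : Fin m) :
    familySeries a d r L Z g (Pi.single (some l) DualNumber.eps : Option ι → DualNumber F) k =
      MvPowerSeries.map (algebraMap F (DualNumber F)) (f k) +
        (DualNumber.eps : DualNumber F) • MvPowerSeries.map (algebraMap F (DualNumber F))
          (((L l).mulVec f + (jacobian f).mulVec (Z l)) k) := by
  set ε : DualNumber F := DualNumber.eps with hε
  have hεε : ε * ε = 0 := DualNumber.eps_mul_eps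
  set ψ : MvPowerSeries (Fin n) F →+* MvPowerSeries (Fin n) (DualNumber F) :=
    MvPowerSeries.map (algebraMap F (DualNumber F)) with hψ
  have hM : familyMatrix L (Pi.single (some l) ε : Option ι → DualNumber F) =
      Matrix.of fun j i => ε • ψ (L l j i) := by
    ext1 j i
    rw [familyMatrix, Matrix.of_apply, Matrix.of_apply, Finset.sum_eq_single l]
    · simp [hψ]
    · intro l' _ hne
      rw [Pi.single_eq_of_ne (by simpa using hne), zero_smul]
    · simp
  have hZ' : familyField Z (Pi.single (some l) ε : Option ι → DualNumber F) =
      fun j => ε • ψ (Z l j) := by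
    ext1 j
    rw [familyField, Finset.sum_eq_single l]
    · simp [hψ]
    · intro l' _ hne
      rw [Pi.single_eq_of_ne (by simpa using hne), zero_smul]
    · simp
  have hsub : ∀ i, subst (fun j => X j + ε • ψ (Z l j)) (ψ (f i)) =
      ψ (f i) + ε • ψ (vectorField (Z l) (f i)) := by
    intro i
    rw [subst_X_add_smul_of_sq_eq_zero ha hεε
      (fun j => map_mem_ordIdeal _ (ordIdeal_anti (Nat.le_succ _) (hZ l j))), hψ, map_vectorField]
  have hscaled : ∀ i, scaledSeries a (r + d i)
      ((Pi.single (some l) ε : Option ι → DualNumber F) none) (g i) = ψ (f i) := by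
    intro i
    rw [Pi.single_eq_of_ne (by simp)]
    exact scaledSeries_zero (hf i) (ordIdeal_anti (by omega) (mem_weightFiltration.1 hg i))
  rw [familySeries, hM, hZ']
  simp only [hscaled, hsub]
  rw [Matrix.add_mulVec, Matrix.one_mulVec, Pi.add_apply, Pi.add_apply, map_add, jacobian_mulVec,
    smul_add, add_assoc, add_comm (ε • ψ (vectorField (Z l) (f k)))]
  congr 2
  rw [Matrix.mulVec, Matrix.mulVec, dotProduct, dotProduct, map_sum, Finset.smul_sum]
  refine Finset.sum_congr rfl fun i _ => ?_
  have hC : (C ε : MvPowerSeries (Fin n) (DualNumber F)) * C ε = 0 := by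
    rw [← map_mul, hεε, map_zero]
  rw [Matrix.of_apply, map_mul]
  simp only [smul_eq_C_mul]
  linear_combination ψ (L l k i) * ψ (vectorField (Z l) (f i)) * hC

/-- For a nonzero parameter the family consists of series contact equivalent to `g`. -/
theorem contactEquiv_scaledSeries {r : ℕ} {g : Fin m → MvPowerSeries (Fin n) F}
    (hg : g ∈ weightFiltration F a d r) {c : F} (hc : c ≠ 0) :
    ContactEquiv g fun i => scaledSeries a (r + d i) c (g i) := by
  have : (fun i => scaledSeries a (r + d i) c (g i)) =
      fun i => (c ^ (r + d i))⁻¹ • rescale (fun j => c ^ a j) (g i) := by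
    ext i α
    have hprod : (α.prod fun j e => (c ^ a j) ^ e) = c ^ Finsupp.weight a α := by
      rw [Finsupp.weight_apply, Finsupp.sum, Finsupp.prod, ← Finset.prod_pow_eq_pow_sum]
      refine Finset.prod_congr rfl fun j _ => ?_
      rw [← pow_mul, smul_eq_mul, mul_comm]
    rw [coeff_scaledSeries, map_smul, coeff_rescale, hprod, smul_eq_mul, Algebra.algebraMap_self,
      RingHom.id_apply, ← mul_assoc]
    by_cases h : Finsupp.weight a α < r + d i
    · rw [mem_ordIdeal_iff_coeff.1 (mem_weightFiltration.1 hg i) α h, mul_zero, mul_zero]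
    · congr 1
      rw [pow_sub₀ c hc (by omega), mul_comm]
  rw [this]
  exact contactEquiv_smul_rescale (fun j => pow_ne_zero _ hc)
    (fun i => inv_ne_zero (pow_ne_zero _ hc)) g

theorem scaledSeries_sub_mem {w : ℕ} {f g : MvPowerSeries (Fin n) F}
    (hg : g - f ∈ ordIdeal F a (w + 1)) (c : F) : scaledSeries a w c g - f ∈ ordIdeal F a (w + 1) := by
  rw [mem_ordIdeal_iff_coeff]
  intro α hα
  have := mem_ordIdeal_iff_coeff.1 hg α hα
  rw [map_sub, sub_eq_zero] at this
  rw [map_sub, coeff_scaledSeries, this, Nat.sub_eq_zero_of_le (by omega), pow_zero, one_mul]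
  exact sub_self _

theorem familyMatrix_mem {s : ℕ} {L : ι → Matrix (Fin m) (Fin m) (MvPowerSeries (Fin n) F)}
    (hL : ∀ l, L l ∈ matrixFiltration F a d s) (x : Option ι → F) :
    familyMatrix L x ∈ matrixFiltration F a d s :=
  mem_matrixFiltration.2 fun j i => Ideal.sum_mem _ fun l _ =>
    smul_mem_ordIdeal _ (map_mem_ordIdeal _ (mem_matrixFiltration.1 (hL l) j i))

end Family

/-! ### Reduction to finite dimension. -/

section Jets

variable {F : Type*} [Field F] {n m : ℕ}

/-- The coefficients of a vector of power series at a finite set of monomials. -/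
noncomputable def jet (B : Finset (Fin m × (Fin n →₀ ℕ))) :
    (Fin m → MvPowerSeries (Fin n) F) →ₗ[F] (B → F) :=
  LinearMap.pi fun b => coeff b.1.2 ∘ₗ LinearMap.proj b.1.1

theorem jet_apply (B : Finset (Fin m × (Fin n →₀ ℕ))) (v : Fin m → MvPowerSeries (Fin n) F)
    (b : B) : jet B v b = coeff b.1.2 (v b.1.1) := rfl

/-- This is the window of relevant monomials: below it vectors of the filtration vanish, above it
determinacy takes over. -/
theorem exists_finset_weight (a : Fin n → ℕ) (ha : ∀ j, 0 < a j) (d : Fin m → ℕ) (p q : ℕ) :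
    ∃ B : Finset (Fin m × (Fin n →₀ ℕ)), ∀ i α, (i, α) ∈ B ↔
      p + d i ≤ Finsupp.weight a α ∧ Finsupp.weight a α < q + d i := by
  classical
  have hfin : ∀ i, {α : Fin n →₀ ℕ | Finsupp.weight a α ≤ q + d i}.Finite := fun i =>
    Finsupp.finite_of_nat_weight_le a (fun j => (ha j).ne') _
  refine ⟨(Finset.univ.biUnion fun i => (hfin i).toFinset.image (Prod.mk i)).filter
    fun x => p + d x.1 ≤ Finsupp.weight a x.2 ∧ Finsupp.weight a x.2 < q + d x.1,
    fun i α => ?_⟩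
  simp only [Finset.mem_filter, Finset.mem_biUnion, Finset.mem_univ, true_and, Finset.mem_image,
    Set.Finite.mem_toFinset, Set.mem_ofPred_eq, Prod.mk.injEq, and_iff_right_iff_imp]
  exact fun h => ⟨i, α, h.2.le, rfl, rfl⟩

/-- A subspace of a finite dimensional space is cut out by linear equations. -/
theorem exists_linearMap_ker_eq {V : Type*} [AddCommGroup V] [Module F V] [FiniteDimensional F V]
    (W : Submodule F V) :
    ∃ (D : ℕ) (q : V →ₗ[F] (Fin D → F)), Function.Surjective q ∧ LinearMap.ker q = W := by
  let e := (Module.finBasis F (V ⧸ W)).equivFun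
  refine ⟨_, e.toLinearMap ∘ₗ W.mkQ, ?_, ?_⟩
  · exact e.surjective.comp W.mkQ_surjective
  · rw [LinearEquiv.ker_comp, Submodule.ker_mkQ]

end Jets

end ContactGeometry

/-! ### The complete transversal theorem. -/

open ContactGeometry in
theorem mainTheorem3 {F : Type*} [Field F] [IsAlgClosed F] {n m : ℕ}
    (a : Fin n → ℕ) (ha : ∀ j, 0 < a j) (d : Fin m → ℕ) (r : ℕ)
    (f : Fin m → MvPowerSeries (Fin n) F)
    (hf : ContactGeometry.IsICIS f)
    (hfw : ContactGeometry.IsWeightedHomog a d r f)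
    (T : Submodule F (Fin m → MvPowerSeries (Fin n) F))
    (hT : T ≤ (ContactGeometry.weightFiltration F a d (r + 1)).restrictScalars F)
    (hcover : (ContactGeometry.weightFiltration F a d (r + 1)).restrictScalars F ≤
      T ⊔ (ContactGeometry.tangentImage a d 1 f).restrictScalars F)
    (g : Fin m → MvPowerSeries (Fin n) F)
    (hg : g - f ∈ ContactGeometry.weightFiltration F a d (r + 1)) :
    ∃ t ∈ T, ContactGeometry.ContactEquiv g (f + t) := by
  classical
  have : Infinite F := IsAlgClosed.instInfinite
  have hwt : ∀ i α, coeff α (f i) ≠ 0 → Finsupp.weight a α = r + d i :=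
    fun i α hα => hfw.weight_eq hα
  have hfr : f ∈ weightFiltration F a d r := by
    refine mem_weightFiltration.2 fun i => mem_ordIdeal_iff_coeff.2 fun α hα => ?_
    by_contra h
    exact absurd (hwt i α h) (by omega)
  have hgr : g ∈ weightFiltration F a d r := by
    simpa using add_mem (weightFiltration_anti (Nat.le_succ r) hg) hfr
  obtain ⟨N, hN, hNT⟩ := exists_weightFiltration_le_tangentImage hf hfw
  obtain ⟨B, hB⟩ := exists_finset_weight a ha d (r + 1) (r + N)
  have hBwt : ∀ b : B, r + 1 + d b.1.1 ≤ Finsupp.weight a b.1.2 ∧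
      Finsupp.weight a b.1.2 < r + N + d b.1.1 := fun b => (hB _ _).1 b.2
  have hjetf : jet B f = 0 := by
    ext b
    rw [jet_apply]
    by_contra h
    have := hBwt b
    exact absurd (hwt _ _ h) (by omega)
  obtain ⟨D, q, hq, hker⟩ := exists_linearMap_ker_eq (T.map (jet B))
  have hqT : ∀ t ∈ T, q (jet B t) = 0 := fun t ht => by
    rw [← LinearMap.mem_ker, hker]
    exact Submodule.mem_map_of_mem ht
  -- tangent vectors spanning the normal space to `T`
  have hex : ∀ l : Fin D, ∃ Λ ∈ matrixFiltration F a d 1, ∃ ξ ∈ weightFiltration F a a 1,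
      q (jet B (Λ.mulVec f + (jacobian f).mulVec ξ)) = Pi.single l 1 := by
    intro l
    obtain ⟨b, hb⟩ := hq (Pi.single l 1)
    -- Lifting `b` by zero outside the window gives a vector of filtration `r + 1`, so the covering
    -- hypothesis applies; `q` kills the component in `T` and leaves a tangent vector.
    let v : Fin m → MvPowerSeries (Fin n) F := fun i α => if h : (i, α) ∈ B then b ⟨_, h⟩ else 0
    have hv : ∀ i α, coeff α (v i) = if h : (i, α) ∈ B then b ⟨_, h⟩ else 0 :=
      fun i α => coeff_apply (v i) α
    have hjv : jet B v = b := by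
      ext x
      rw [jet_apply, hv, dif_pos x.2]
    have hvr : v ∈ weightFiltration F a d (r + 1) := by
      refine mem_weightFiltration.2 fun i => mem_ordIdeal_iff_coeff.2 fun α hα => ?_
      rw [hv, dif_neg]
      rw [hB]
      omega
    obtain ⟨t, ht, w, ⟨Λ, hΛ, ξ, hξ, hw⟩, htw⟩ := Submodule.mem_sup.1 (hcover hvr)
    refine ⟨Λ, hΛ, ξ, hξ, ?_⟩
    rw [← hw, ← hb, ← hjv, ← htw, map_add, map_add, hqT t ht, zero_add]
  choose L hL Z hZ hLZ using hex
  have hZ' : ∀ l j, Z l j ∈ ordIdeal F a (a j + 1) := fun l => mem_weightFiltration_self.1 (hZ l)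
  have hqsum : ∀ (v : B → F) (i : Fin D), q v i = ∑ b, q (Pi.single b 1) i * v b := by
    intro v i
    rw [LinearMap.pi_apply_eq_sum_univ q v, Finset.sum_apply]
    refine Finset.sum_congr rfl fun b _ => ?_
    have : (fun c => if b = c then 1 else 0 : B → F) = Pi.single b 1 := by
      ext c
      simp [Pi.single_apply, eq_comm]
    rw [Pi.smul_apply, smul_eq_mul, mul_comm, this]
  -- the polynomial equations for the family to meet `f + T` up to higher order terms
  let P : Fin D → MvPolynomial (Option (Fin D)) F := fun i =>
    ∑ b : B, MvPolynomial.C (q (Pi.single b 1) i) *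
      coeff b.1.2 (familySeries a d r L Z g MvPolynomial.X b.1.1)
  have hP : ∀ {A : Type _} [CommRing A] [Algebra F A] (x : Option (Fin D) → A) (i : Fin D),
      MvPolynomial.aeval x (P i) = ∑ b : B, algebraMap F A (q (Pi.single b 1) i) *
        coeff b.1.2 (familySeries a d r L Z g x b.1.1) := by
    intro A _ _ x i
    rw [map_sum]
    refine Finset.sum_congr rfl fun b _ => ?_
    have h := congrArg (coeff b.1.2)
      (map_familySeries (d := d) ha (MvPolynomial.aeval x) r L hZ' g MvPolynomial.X b.1.1)
    simp only [coeff_map, MvPolynomial.aeval_X] at h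
    rw [map_mul, MvPolynomial.aeval_C, ← h]
    rfl
  -- At `ε eₗ` the family is `f` plus `ε` times the `l`-th tangent vector. The jet of `f` is 0 and
  -- the tangent vectors are dual to the equations.
  have hlin : ∀ i l, TrivSqZeroExt.inl ((P i).coeff 0) +
      TrivSqZeroExt.inr ((P i).coeff (Finsupp.single (some l) 1)) =
        (TrivSqZeroExt.inr (if i = l then 1 else 0) : DualNumber F) := by
    intro i l
    rw [← aeval_single_eps, hP]
    have hterm : ∀ b : B, coeff b.1.2 (familySeries a d r L Z g
        (Pi.single (some l) DualNumber.eps : Option (Fin D) → DualNumber F) b.1.1) =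
        TrivSqZeroExt.inr (jet B ((L l).mulVec f + (jacobian f).mulVec (Z l)) b) := by
      intro b
      rw [familySeries_single_eps ha L hZ' hwt hg, map_add, coeff_map, map_smul, coeff_map,
        jet_apply, ← jet_apply B f b, hjetf]
      ext <;> simp [TrivSqZeroExt.algebraMap_eq_inl]
    simp only [hterm, TrivSqZeroExt.algebraMap_eq_inl, TrivSqZeroExt.inl_mul_inr, smul_eq_mul]
    rw [← TrivSqZeroExt.inr_sum, ← hqsum, hLZ, Pi.single_apply]
  have hP0 : ∀ i, (P i).coeff 0 = 0 := fun i => by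
    simpa using congrArg TrivSqZeroExt.fst (hlin i i)
  have hP1 : ∀ i l, (P i).coeff (Finsupp.single (some l) 1) = if i = l then 1 else 0 :=
    fun i l => by
      have := congrArg TrivSqZeroExt.snd (hlin i l)
      rwa [TrivSqZeroExt.snd_add, TrivSqZeroExt.snd_inl, zero_add, TrivSqZeroExt.snd_inr,
        TrivSqZeroExt.snd_inr] at this
  -- The solution need not be near the origin: `1 + ∑ xₗ Λₗ` and the coordinate change are
  -- invertible for all values of the `xₗ`.
  obtain ⟨x, hx, hPx⟩ := exists_solution_param_ne_zero hP0 hP1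
  set gx : Fin m → MvPowerSeries (Fin n) F :=
    fun i => scaledSeries a (r + d i) (x none) (g i) with hgx
  set G : Fin m → MvPowerSeries (Fin n) F := familySeries a d r L Z g x with hG
  have hM := familyMatrix_mem hL x
  have hV := fun j => familyField_mem hZ' x j
  have hgxf : gx - f ∈ weightFiltration F a d (r + 1) := mem_weightFiltration.2 fun i =>
    ordIdeal_anti (by omega) (scaledSeries_sub_mem
      (ordIdeal_anti (by omega) (mem_weightFiltration.1 hg i)) _)
  have hggx : ContactEquiv g gx := contactEquiv_scaledSeries hgr hx
  have hgxG : ContactEquiv gx G :=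
    contactEquiv_one_add_mulVec_subst ha hM (mem_weightFiltration_self.2 hV) gx
  have hGf : G - f ∈ weightFiltration F a d (r + 1) := by
    have hgxr : gx ∈ weightFiltration F a d r := by
      simpa using add_mem (weightFiltration_anti (Nat.le_succ r) hgxf) hfr
    set K : Fin m → MvPowerSeries (Fin n) F :=
      fun i => subst (fun j => X j + familyField Z x j) (gx i) with hK
    have h1 : K - gx ∈ weightFiltration F a d (r + 1) := mem_weightFiltration.2 fun i =>
      ordIdeal_anti (by omega) (subst_X_add_sub_mem ha hV (mem_weightFiltration.1 hgxr i))
    have h2 : K ∈ weightFiltration F a d r := by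
      simpa using add_mem (weightFiltration_anti (Nat.le_succ r) h1) hgxr
    have h3 : G = K + (familyMatrix L x).mulVec K := by
      rw [hG, familySeries, Matrix.add_mulVec, Matrix.one_mulVec]
    have h4 := add_mem (add_mem h1 hgxf) (mulVec_mem_weightFiltration hM h2)
    rw [h3]
    convert h4 using 1
    abel
  have hjG : jet B G ∈ T.map (jet B) := by
    rw [← hker, LinearMap.mem_ker]
    ext i
    have := hPx i
    rw [hP] at this
    rw [hqsum]
    exact this
  obtain ⟨t, ht, htG⟩ := hjG
  -- Below the window the difference vanishes by filtration, inside it by equality of jets.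
  have hrem : f + t - G ∈ weightFiltration F a d (r + N) := by
    have h1 : f + t - G ∈ weightFiltration F a d (r + 1) := by
      have htr : t ∈ weightFiltration F a d (r + 1) := hT ht
      convert sub_mem htr hGf using 1
      abel
    have h2 : jet B (f + t - G) = 0 := by
      rw [map_sub, map_add, hjetf, htG, zero_add, sub_self]
    refine mem_weightFiltration.2 fun i => mem_ordIdeal_iff_coeff.2 fun α hα => ?_
    by_cases h : Finsupp.weight a α < r + 1 + d i
    · exact mem_ordIdeal_iff_coeff.1 (mem_weightFiltration.1 h1 i) α h
    · exact congrFun h2 ⟨(i, α), (hB i α).2 ⟨by omega, hα⟩⟩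
  refine ⟨t, ht, hggx.trans (hgxG.trans ?_)⟩
  have := contactEquiv_add_of_le_tangentImage ha hN hfr hNT hGf hrem
  rwa [add_sub_cancel] at this
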